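/- Let $A,B\in\mathbb{C}^{n\times n}$ be such that the pencil $zB-A$ is regular, i.e. $\det(zB-A)$ is not identically zero in $z\in\mathbb{C}$. Let $\Gamma$ be a positively oriented rectifiable simple closed curve in $\mathbb{C}$ on which no eigenvalue of the pencil lies, i.e. $\det(zB-A)\neq 0$ for all $z\in\Gamma$. Then the contour integral $$Q:=\frac{1}{2\pi\mathrm{i}}\oint_\Gamma (zB-A)^{-1}B\,dz$$ exists, and the following holds. There are nonsingular $S,T\in\mathbb{C}^{n\times n}$ bringing the pencil to Weierstrass canonical form $$TAS=\begin{bmatrix}J_d&0\\0&I_{n-d}\end{bmatrix},\qquad TBS=\begin{bmatrix}I_d&0\\0&N_{n-d}\end{bmatrix},$$ where $J_d=\mathrm{diag}(J_{d_1}(\lambda_1),\dots,J_{d_m}(\lambda_m))$ is in Jordan canonical form ($J_{d_i}(\lambda_i)$ being the $d_i\times d_i$ upper triangular Jordan block with eigenvalue $\lambda_i$; the $\lambda_i$ need not be distinct) and $N_{n-d}$ is nilpotent and in Jordan canonical form, with the blocks of $J_d$ ordered so that, for some $0\le l\le m$, $\lambda_i$ lies inside $\Gamma$ if and only if $i\le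 l$. For every such $S,T$ and ordering, put $s:=d_1+\dots+d_l$. Let $S_{(:,1:s)}$ denote the matrix of the first $s$ columns of $S$, $(S^{-1})_{(1:s,:)}$ the matrix of the first $s$ rows of $S^{-1}$, and let $\mathcal{K}:=\mathrm{span}\{S_{(:,1:s)}\}$ be the span of the columns of $S_{(:,1:s)}$. Then: 1. $\displaystyle Q=S\begin{bmatrix}I_s&0\\0&0\end{bmatrix}S^{-1}=S_{(:,1:s)}(S^{-1})_{(1:s,:)}$; 2. $Q^2=Q$ and the range of $Q$ is $\mathcal{K}$, i.e. $Q$ is a projector onto $\mathcal{K}$; 3. for every $\mu$ inside $\Gamma$, the eigenspace $\{x\in\mathbb{C}^n: Ax=\mu Bx\}$ is contained in $\mathcal{K}$; 4. $A\mathcal{K}\subseteq B\mathcal{K}$; 5. $s$ is the number of eigenvalues of the pencil inside $\Gamma$, counted with algebraic multiplicity (as roots of $\det(zB-A)$), and $\mathrm{trace}(Q)=s$; 6. consequently, for every $p\ge1$, if $Y$ is a random real $n\times p$ matrix with i.i.d. standard normal entries and $U:=QY$, then $\mathrm{trace}(Y^*U)$ is integrable and $\frac1p\,\mathbb{E}[\mathrm{trace}(Y^*U)]=\mathrm{trace}(Q)=s$.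 -/

import Mathlib

open Matrix MeasureTheory ProbabilityTheory

noncomputable section

/-! ### Contours -/

/-- A rectifiable simple closed curve in the complex plane, given by an absolutely continuous
parametrization of `[a, b]` that is injective up to its coinciding endpoints.  Every piecewise
continuously differentiable parametrization, and the arc length parametrization of every
rectifiable curve, is absolutely continuous. -/
structure SimpleClosedCurve where
  a : ℝ
  b : ℝ
  a_lt_b : a < b
  γ : ℝ → ℂ
  absCont : AbsolutelyContinuousOnInterval γ a b
  closed : γ a = γ b
  simple : Set.InjOn γ (Set.Ico a b)

namespace SimpleClosedCurve

/-- The set of points on the curve. -/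
def support (Γ : SimpleClosedCurve) : Set ℂ := Γ.γ '' Set.Icc Γ.a Γ.b

/-- The points enclosed by the curve: those off the curve whose connected component in the
complement of the curve is bounded. -/
def inside (Γ : SimpleClosedCurve) : Set ℂ :=
  {w | w ∈ Γ.supportᶜ ∧ Bornology.IsBounded (connectedComponentIn Γ.supportᶜ w)}

/-- The contour integral of `f` along `Γ` exists. -/
def ContourIntegrable (Γ : SimpleClosedCurve) (f : ℂ → ℂ) : Prop :=
  IntervalIntegrable (fun t => f (Γ.γ t) * deriv Γ.γ t) volume Γ.a Γ.b

/-- The contour integral `∮_Γ f(z) dz`. -/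
def contourIntegral (Γ : SimpleClosedCurve) (f : ℂ → ℂ) : ℂ :=
  ∫ t in Γ.a..Γ.b, f (Γ.γ t) * deriv Γ.γ t

/-- The winding number of `Γ` around `w`, for `w` off the curve. -/
def windingNumber (Γ : SimpleClosedCurve) (w : ℂ) : ℂ :=
  (2 * Real.pi * Complex.I)⁻¹ * Γ.contourIntegral (fun z => (z - w)⁻¹)

/-- `Γ` runs once counterclockwise around the points it encloses. -/
def PositivelyOriented (Γ : SimpleClosedCurve) : Prop :=
  ∀ w ∈ Γ.inside, Γ.windingNumber w = 1

end SimpleClosedCurve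

/-! ### Matrix pencils -/

/-- The pencil `zB - A` is regular: `det (zB - A)` is not identically zero in `z`. -/
def IsRegularPencil {n : ℕ} (A B : Matrix (Fin n) (Fin n) ℂ) : Prop :=
  ∃ z : ℂ, (z • B - A).det ≠ 0

/-- The polynomial `det (zB - A)` in the indeterminate `z`. -/
def pencilPolynomial {n : ℕ} (A B : Matrix (Fin n) (Fin n) ℂ) : Polynomial ℂ :=
  ((Polynomial.X : Polynomial ℂ) • B.map Polynomial.C - A.map Polynomial.C).det

/-- The number of eigenvalues of the pencil enclosed by `Γ`, each counted with its algebraic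
multiplicity, that is, as a root of `det (zB - A)`. -/
def eigenvalueCount {n : ℕ} (A B : Matrix (Fin n) (Fin n) ℂ) (Γ : SimpleClosedCurve) : ℕ :=
  open Classical in ((pencilPolynomial A B).roots.filter (fun z => z ∈ Γ.inside)).card

/-- The eigenspace `{x | Ax = μBx}`. -/
def pencilEigenspace {n : ℕ} (A B : Matrix (Fin n) (Fin n) ℂ) (μ : ℂ) :
    Submodule ℂ (Fin n → ℂ) :=
  LinearMap.ker (Matrix.mulVecLin (μ • B - A))

/-- The `k × k` upper triangular Jordan block with eigenvalue `μ`. -/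
def jordanBlock (k : ℕ) (μ : ℂ) : Matrix (Fin k) (Fin k) ℂ :=
  Matrix.of fun i j => if i = j then μ else if (i : ℕ) + 1 = j then 1 else 0

/-- The block diagonal matrix `diag (J_{k₁}(μ₁), …, J_{kₘ}(μₘ))`, with the blocks in this order
along the diagonal. -/
def jordanMatrix {m : ℕ} (k : Fin m → ℕ) (μ : Fin m → ℂ) :
    Matrix (Fin (∑ i, k i)) (Fin (∑ i, k i)) ℂ :=
  Matrix.reindex finSigmaFinEquiv finSigmaFinEquiv
    (Matrix.blockDiagonal' fun i => jordanBlock (k i) (μ i))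

/-- The matrix `[X 0; 0 Y]` of order `n = p + q`. -/
def diagBlocks {p q n : ℕ} (h : p + q = n) (X : Matrix (Fin p) (Fin p) ℂ)
    (Y : Matrix (Fin q) (Fin q) ℂ) : Matrix (Fin n) (Fin n) ℂ :=
  Matrix.reindex (finSumFinEquiv.trans (finCongr h)) (finSumFinEquiv.trans (finCongr h))
    (Matrix.fromBlocks X 0 0 Y)

/-- A reduction of the pencil `zB - A` to Weierstrass canonical form:
`TAS = [J 0; 0 I]` and `TBS = [I 0; 0 N]` with `S`, `T` nonsingular, `J` in Jordan canonical form
and `N` nilpotent in Jordan canonical form. -/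
structure WeierstrassForm {n : ℕ} (A B : Matrix (Fin n) (Fin n) ℂ) where
  /-- the number of Jordan blocks of `J` -/
  m : ℕ
  /-- the sizes of the Jordan blocks of `J` -/
  d : Fin m → ℕ
  d_pos : ∀ i, 0 < d i
  /-- the eigenvalues of the Jordan blocks of `J` -/
  eig : Fin m → ℂ
  /-- the number of Jordan blocks of `N` -/
  m' : ℕ
  /-- the sizes of the Jordan blocks of `N` -/
  d' : Fin m' → ℕ
  d'_pos : ∀ j, 0 < d' j
  order_eq : ∑ i, d i + ∑ j, d' j = n
  S : Matrix (Fin n) (Fin n) ℂ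
  T : Matrix (Fin n) (Fin n) ℂ
  isUnit_S : IsUnit S
  isUnit_T : IsUnit T
  mul_A : T * A * S = diagBlocks order_eq (jordanMatrix d eig) 1
  mul_B : T * B * S = diagBlocks order_eq 1 (jordanMatrix d' fun _ => 0)

namespace WeierstrassForm

variable {n : ℕ} {A B : Matrix (Fin n) (Fin n) ℂ}

/-- The Jordan blocks of `J` whose eigenvalues are enclosed by `Γ` are exactly the first `l`. -/
def EnclosedFirst (W : WeierstrassForm A B) (Γ : SimpleClosedCurve) (l : ℕ) : Prop :=
  l ≤ W.m ∧ ∀ i : Fin W.m, W.eig i ∈ Γ.inside ↔ (i : ℕ) < l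

/-- The total size `s = d₁ + ⋯ + d_l` of the first `l` Jordan blocks. -/
def size (W : WeierstrassForm A B) (l : ℕ) : ℕ :=
  ∑ i ∈ Finset.univ.filter (fun i : Fin W.m => (i : ℕ) < l), W.d i

theorem size_le (W : WeierstrassForm A B) (l : ℕ) : W.size l ≤ n := by
  have h1 : W.size l ≤ ∑ i, W.d i :=
    Finset.sum_le_sum_of_subset (Finset.filter_subset _ _)
  have h2 := W.order_eq
  omega

/-- The matrix `S_{(:,1:s)}` of the first `s = d₁ + ⋯ + d_l` columns of `S`. -/
def leadingCols (W : WeierstrassForm A B) (l : ℕ) : Matrix (Fin n) (Fin (W.size l)) ℂ :=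
  W.S.submatrix id (Fin.castLE (W.size_le l))

/-- The matrix `(S⁻¹)_{(1:s,:)}` of the first `s = d₁ + ⋯ + d_l` rows of `S⁻¹`. -/
def leadingInvRows (W : WeierstrassForm A B) (l : ℕ) : Matrix (Fin (W.size l)) (Fin n) ℂ :=
  (W.S⁻¹).submatrix (Fin.castLE (W.size_le l)) id

/-- The subspace spanned by the first `s = d₁ + ⋯ + d_l` columns of `S`. -/
def leadingSpan (W : WeierstrassForm A B) (l : ℕ) : Submodule ℂ (Fin n → ℂ) :=
  Submodule.span ℂ (Set.range (W.leadingCols l).col)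

end WeierstrassForm

/-- The matrix `Q = (1 / 2πi) ∮_Γ (zB - A)⁻¹ B dz`, integrated entry by entry. -/
def contourProjector {n : ℕ} (A B : Matrix (Fin n) (Fin n) ℂ) (Γ : SimpleClosedCurve) :
    Matrix (Fin n) (Fin n) ℂ :=
  Matrix.of fun i j =>
    (2 * Real.pi * Complex.I)⁻¹ * Γ.contourIntegral (fun z => ((z • B - A)⁻¹ * B) i j)

/-- `Y` is a random `n × p` matrix with independent standard normal entries. -/
def IsStandardGaussianMatrix {Ω : Type*} [MeasurableSpace Ω] (P : Measure Ω) {n p : ℕ}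
    (Y : Ω → Matrix (Fin n) (Fin p) ℝ) : Prop :=
  (∀ i j, HasLaw (fun ω => Y ω i j) (gaussianReal 0 1) P) ∧
    iIndepFun (fun (ij : Fin n × Fin p) ω => Y ω ij.1 ij.2) P

end

/-! ### Absolutely continuous functions with complex values -/

/-! Weierstrass form reduces the integral to Jordan blocks. From `T (zB - A) S = diag (zI - J, zN -
I)` one gets `(zB - A)⁻¹ B = S diag ((zI - J)⁻¹, (zN - I)⁻¹ N) S⁻¹`. As `N` is nilpotent, the second
block is a polynomial in `z` and integrates to zero. The first is a finite Neumann series in powers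
of `(z - λ)⁻¹`. Exponents at least two have a primitive off `λ`, so only the diagonal terms `(z -
λ)⁻¹` survive, and they give winding numbers. Hence `Q = S diag (I_s, 0) S⁻¹`
(`EnclosedFirst.hasMatrixContourIntegral`), from which the projector, its range and its trace are
read off.

Winding number one inside `Γ` is the definition of positive orientation. Off the curve and not
inside, the component is unbounded; the winding number is constant on it and decays at infinity,
hence is zero (`windingNumber_eq_zero`). The Jordan curve theorem is not needed. Since the curve is
only absolutely continuous, integrals of functions with a primitive `F` are evaluated by noting that
`F ∘ γ` is again absolutely continuous (`HasContourIntegral.of_primitive`).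

The canonical form exists because, for `det (zB - A) ≠ 0`, the Fitting decomposition of `M = (zB -
A)⁻¹ B` separates the infinite eigenvalue (`M` nilpotent) from the finite ones (`M` invertible), and
each part has a Jordan basis by the structure theorem for torsion `ℂ[X]`-modules.

The remaining claims are short: `Q` fixes eigenvectors with enclosed eigenvalue, triangularity of
`J` gives `A𝒦 ⊆ B𝒦`, determinants of the blocks give the multiplicity count, and uncorrelated
unit-variance entries give the trace estimate. -/

theorem AbsolutelyContinuousOnInterval.lipschitzOnWith_comp {X Y : Type*} [PseudoMetricSpace X]
    [PseudoMetricSpace Y] {f : ℝ → X} {g : X → Y} {a b : ℝ} {K : NNReal}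
    (hf : AbsolutelyContinuousOnInterval f a b)
    (hg : LipschitzOnWith K g (f '' Set.uIcc a b)) :
    AbsolutelyContinuousOnInterval (fun t => g (f t)) a b := by
  -- Absolute continuity unfolds to convergence to 0 of the sums of `dist` over finite disjoint
  -- families of intervals of small total length; `K` times these sums dominates the sums for `g ∘
  -- f`.
  have hK : Filter.Tendsto _ _ _ := Filter.Tendsto.const_mul (K : ℝ) hf
  rw [mul_zero] at hK
  refine squeeze_zero' (Filter.Eventually.of_forall fun E =>
    Finset.sum_nonneg fun i _ => dist_nonneg) ?_ hK
  refine Filter.eventually_inf_principal.2 (Filter.Eventually.of_forall fun E hE => ?_)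
  rw [Finset.mul_sum]
  refine Finset.sum_le_sum fun i hi => ?_
  exact hg.dist_le_mul _ (Set.mem_image_of_mem _ (hE.1 i hi).1) _
    (Set.mem_image_of_mem _ (hE.1 i hi).2)

section ComplexValued

theorem intervalIntegrable_ofReal {f : ℝ → ℝ} {a b : ℝ} (hf : IntervalIntegrable f volume a b) :
    IntervalIntegrable (fun t => (f t : ℂ)) volume a b :=
  ⟨hf.1.ofReal, hf.2.ofReal⟩

variable {f : ℝ → ℂ} {a b : ℝ}

theorem AbsolutelyContinuousOnInterval.re (hf : AbsolutelyContinuousOnInterval f a b) :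
    AbsolutelyContinuousOnInterval (fun t => (f t).re) a b :=
  hf.lipschitzOnWith_comp (g := Complex.re) (K := 1)
    (LipschitzWith.of_dist_le_mul fun x y => by
      simpa [dist_eq_norm] using Complex.abs_re_le_norm (x - y)).lipschitzOnWith

theorem AbsolutelyContinuousOnInterval.im (hf : AbsolutelyContinuousOnInterval f a b) :
    AbsolutelyContinuousOnInterval (fun t => (f t).im) a b :=
  hf.lipschitzOnWith_comp (g := Complex.im) (K := 1)
    (LipschitzWith.of_dist_le_mul fun x y => by
      simpa [dist_eq_norm] using Complex.abs_im_le_norm (x - y)).lipschitzOnWith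

/-- Real and imaginary parts are absolutely continuous, hence differentiable almost everywhere.
Writing the derivative through the parts lets integrability and the fundamental theorem carry over
from the real case. -/
theorem AbsolutelyContinuousOnInterval.ae_hasDerivAt_complex
    (hf : AbsolutelyContinuousOnInterval f a b) :
    ∀ᵐ t : ℝ, t ∈ Set.uIcc a b → HasDerivAt f
      (((deriv (fun t => (f t).re) t : ℝ) : ℂ) + ((deriv (fun t => (f t).im) t : ℝ) : ℂ) * Complex.I) t := by
  filter_upwards [hf.re.ae_differentiableAt, hf.im.ae_differentiableAt] with t h1 h2 ht
  have h := (h1 ht).hasDerivAt.ofReal_comp.add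
    ((h2 ht).hasDerivAt.ofReal_comp.mul_const Complex.I)
  refine h.congr_of_eventuallyEq (Filter.Eventually.of_forall fun s => ?_)
  exact (Complex.re_add_im (f s)).symm

theorem AbsolutelyContinuousOnInterval.intervalIntegrable_deriv_complex
    (hf : AbsolutelyContinuousOnInterval f a b) :
    IntervalIntegrable (deriv f) volume a b := by
  have h : IntervalIntegrable (fun t => ((deriv (fun t => (f t).re) t : ℝ) : ℂ) +
      ((deriv (fun t => (f t).im) t : ℝ) : ℂ) * Complex.I) volume a b :=
    (intervalIntegrable_ofReal hf.re.intervalIntegrable_deriv).add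
      ((intervalIntegrable_ofReal hf.im.intervalIntegrable_deriv).mul_const Complex.I)
  refine h.congr_ae ?_
  rw [Filter.EventuallyEq, ae_restrict_iff' measurableSet_uIoc]
  filter_upwards [hf.ae_hasDerivAt_complex] with t ht hmem
  exact (ht (Set.uIoc_subset_uIcc hmem)).deriv.symm

theorem AbsolutelyContinuousOnInterval.integral_deriv_complex
    (hf : AbsolutelyContinuousOnInterval f a b) :
    ∫ t in a..b, deriv f t = f b - f a := by
  have h : ∫ t in a..b, deriv f t = ∫ t in a..b, (((deriv (fun t => (f t).re) t : ℝ) : ℂ) +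
      ((deriv (fun t => (f t).im) t : ℝ) : ℂ) * Complex.I) := by
    refine intervalIntegral.integral_congr_ae ?_
    filter_upwards [hf.ae_hasDerivAt_complex] with t ht hmem
    exact (ht (Set.uIoc_subset_uIcc hmem)).deriv
  rw [h, intervalIntegral.integral_add (intervalIntegrable_ofReal hf.re.intervalIntegrable_deriv)
    ((intervalIntegrable_ofReal hf.im.intervalIntegrable_deriv).mul_const Complex.I),
    intervalIntegral.integral_mul_const, intervalIntegral.integral_ofReal,
    intervalIntegral.integral_ofReal, hf.re.integral_deriv_eq_sub, hf.im.integral_deriv_eq_sub]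
  apply Complex.ext <;> simp

end ComplexValued

/-! ### Contour integrals -/

namespace SimpleClosedCurve

variable (Γ : SimpleClosedCurve)

theorem uIcc_eq : Set.uIcc Γ.a Γ.b = Set.Icc Γ.a Γ.b := Set.uIcc_of_le Γ.a_lt_b.le

theorem continuousOn : ContinuousOn Γ.γ (Set.Icc Γ.a Γ.b) := by
  simpa [Γ.uIcc_eq] using Γ.absCont.continuousOn

theorem isCompact_support : IsCompact Γ.support := isCompact_Icc.image_of_continuousOn Γ.continuousOn

theorem isOpen_compl_support : IsOpen Γ.supportᶜ := Γ.isCompact_support.isClosed.isOpen_compl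

theorem intervalIntegrable_deriv : IntervalIntegrable (deriv Γ.γ) volume Γ.a Γ.b :=
  Γ.absCont.intervalIntegrable_deriv_complex

/-- The contour integral of `f` along `Γ` exists and has the value `v`. -/
def HasContourIntegral (f : ℂ → ℂ) (v : ℂ) : Prop :=
  Γ.ContourIntegrable f ∧ Γ.contourIntegral f = v

variable {Γ}

theorem contourIntegrable_of_continuousOn {f : ℂ → ℂ} (hf : ContinuousOn f Γ.support) :
    Γ.ContourIntegrable f := by
  refine Γ.intervalIntegrable_deriv.continuousOn_mul ?_
  rw [Γ.uIcc_eq]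
  exact hf.comp Γ.continuousOn fun t ht => Set.mem_image_of_mem _ ht

namespace HasContourIntegral

variable {f g : ℂ → ℂ} {v w : ℂ}

theorem congr (hf : Γ.HasContourIntegral f v) (h : ∀ z ∈ Γ.support, f z = g z) :
    Γ.HasContourIntegral g v := by
  have key : Set.EqOn (fun t => f (Γ.γ t) * deriv Γ.γ t) (fun t => g (Γ.γ t) * deriv Γ.γ t)
      (Set.uIcc Γ.a Γ.b) := fun t ht => by
    simp only [h _ (Set.mem_image_of_mem _ (Γ.uIcc_eq ▸ ht))]
  refine ⟨hf.1.congr (key.mono Set.uIoc_subset_uIcc), ?_⟩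
  rw [← hf.2]
  exact (intervalIntegral.integral_congr key).symm

theorem add (hf : Γ.HasContourIntegral f v) (hg : Γ.HasContourIntegral g w) :
    Γ.HasContourIntegral (fun z => f z + g z) (v + w) := by
  obtain ⟨hf, rfl⟩ := hf
  obtain ⟨hg, rfl⟩ := hg
  unfold HasContourIntegral ContourIntegrable contourIntegral at *
  simp only [add_mul]
  exact ⟨hf.add hg, intervalIntegral.integral_add hf hg⟩

theorem const_mul (c : ℂ) (hf : Γ.HasContourIntegral f v) :
    Γ.HasContourIntegral (fun z => c * f z) (c * v) := by
  obtain ⟨hf, rfl⟩ := hf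
  unfold HasContourIntegral ContourIntegrable contourIntegral at *
  simp only [mul_assoc]
  exact ⟨hf.const_mul c, intervalIntegral.integral_const_mul _ _⟩

theorem mul_const (c : ℂ) (hf : Γ.HasContourIntegral f v) :
    Γ.HasContourIntegral (fun z => f z * c) (v * c) := by
  simpa only [mul_comm] using hf.const_mul c

theorem zero : Γ.HasContourIntegral (fun _ => 0) 0 := by
  simp [HasContourIntegral, ContourIntegrable, contourIntegral]

theorem sum {ι : Type*} (s : Finset ι) {F : ι → ℂ → ℂ} {V : ι → ℂ}
    (h : ∀ i ∈ s, Γ.HasContourIntegral (F i) (V i)) :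
    Γ.HasContourIntegral (fun z => ∑ i ∈ s, F i z) (∑ i ∈ s, V i) := by
  classical
  induction s using Finset.induction_on with
  | empty => simpa using zero
  | insert i s hi ih =>
    simp only [Finset.sum_insert hi]
    exact (h i (Finset.mem_insert_self i s)).add
      (ih fun j hj => h j (Finset.mem_insert_of_mem hj))

/-- The integral along a closed curve of a function with a primitive near the curve vanishes. -/
theorem of_primitive {F : ℂ → ℂ} {U : Set ℂ} (hU : IsOpen U) (hΓ : Γ.support ⊆ U)
    (hF : ∀ z ∈ U, HasDerivAt F (f z) z) : Γ.HasContourIntegral f 0 := by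
  have hFd : DifferentiableOn ℂ F U := fun z hz => (hF z hz).differentiableAt.differentiableWithinAt
  have hfc : ContinuousOn f Γ.support :=
    ((hFd.deriv hU).continuousOn.congr fun z hz => (hF z hz).deriv.symm).mono hΓ
  refine ⟨contourIntegrable_of_continuousOn hfc, ?_⟩
  -- A holomorphic `F` is `C¹`, so locally Lipschitz, and therefore Lipschitz on the compact curve.
  -- This makes `F ∘ γ` absolutely continuous, and its increment is the integral of its derivative.
  have hloc : LocallyLipschitzOn Γ.support F := by
    intro z hz
    have h1 : ContDiffAt ℂ 1 F z := (hFd.analyticAt (hU.mem_nhds (hΓ hz))).contDiffAt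
    obtain ⟨K, t, ht, hK⟩ := h1.exists_lipschitzOnWith
    exact ⟨K, t, mem_nhdsWithin_of_mem_nhds ht, hK⟩
  obtain ⟨K, hK⟩ := hloc.exists_lipschitzOnWith_of_compact Γ.isCompact_support
  have hac : AbsolutelyContinuousOnInterval (fun t => F (Γ.γ t)) Γ.a Γ.b :=
    Γ.absCont.lipschitzOnWith_comp (by rw [Γ.uIcc_eq]; exact hK)
  have h2 : Γ.contourIntegral f = ∫ t in Γ.a..Γ.b, deriv (fun t => F (Γ.γ t)) t := by
    refine intervalIntegral.integral_congr_ae ?_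
    filter_upwards [Γ.absCont.ae_hasDerivAt_complex] with t ht hmem
    have hmem' := Set.uIoc_subset_uIcc hmem
    have h3 := ht hmem'
    have h4 := hF (Γ.γ t) (hΓ (Set.mem_image_of_mem _ (Γ.uIcc_eq ▸ hmem')))
    exact (h4.scomp t h3.differentiableAt.hasDerivAt).deriv.trans (by simp [mul_comm]) |>.symm
  rw [h2, hac.integral_deriv_complex, Γ.closed, sub_self]

theorem inv_sub_pow {w : ℂ} (hw : w ∉ Γ.support) (k : ℕ) :
    Γ.HasContourIntegral (fun z => ((z - w)⁻¹) ^ (k + 2)) 0 := by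
  refine of_primitive (F := fun z => -((k : ℂ) + 1)⁻¹ * ((z - w)⁻¹) ^ (k + 1)) (U := {w}ᶜ)
    isOpen_compl_singleton (fun z hz h => hw (h ▸ hz)) fun z hz => ?_
  have hz' : z - w ≠ 0 := sub_ne_zero.2 hz
  have hk : (k : ℂ) + 1 ≠ 0 := Nat.cast_add_one_ne_zero k
  have h := ((((hasDerivAt_id z).sub_const w).inv hz').pow (k + 1)).const_mul (-((k : ℂ) + 1)⁻¹)
  refine h.congr_deriv ?_
  simp only [Nat.add_sub_cancel, Nat.cast_add, Nat.cast_one, id_eq, Pi.inv_apply, inv_pow]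
  field_simp
  ring

theorem pow (k : ℕ) : Γ.HasContourIntegral (fun z => z ^ k) 0 := by
  refine of_primitive (F := fun z => ((k : ℂ) + 1)⁻¹ * z ^ (k + 1)) isOpen_univ
    (Set.subset_univ _) fun z _ => ?_
  have hk : (k : ℂ) + 1 ≠ 0 := Nat.cast_add_one_ne_zero k
  refine ((hasDerivAt_pow (k + 1) z).const_mul _).congr_deriv ?_
  simp only [Nat.add_sub_cancel, Nat.cast_add, Nat.cast_one]
  field_simp

end HasContourIntegral

theorem hasContourIntegral_inv_sub {w : ℂ} (hw : w ∉ Γ.support) :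
    Γ.HasContourIntegral (fun z => (z - w)⁻¹) (2 * Real.pi * Complex.I * Γ.windingNumber w) := by
  refine ⟨contourIntegrable_of_continuousOn ?_, ?_⟩
  · exact (continuousOn_id.sub continuousOn_const).inv₀ fun z hz h => hw ((sub_eq_zero.1 h : z = w) ▸ hz)
  · rw [windingNumber, mul_inv_cancel_left₀ (by simp [Real.pi_ne_zero])]

/-! ### Winding numbers -/

theorem norm_contourIntegral_le {f : ℂ → ℂ} {C : ℝ} (hC : ∀ z ∈ Γ.support, ‖f z‖ ≤ C) :
    ‖Γ.contourIntegral f‖ ≤ C * ∫ t in Γ.a..Γ.b, ‖deriv Γ.γ t‖ := by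
  rw [← intervalIntegral.integral_const_mul]
  refine intervalIntegral.norm_integral_le_of_norm_le Γ.a_lt_b.le ?_
    (Γ.intervalIntegrable_deriv.norm.const_mul C)
  refine Filter.Eventually.of_forall fun t ht => ?_
  rw [norm_mul]
  exact mul_le_mul_of_nonneg_right (hC _ (Set.mem_image_of_mem _ (Set.Ioc_subset_Icc_self ht)))
    (norm_nonneg _)

/-- The formal derivative is `∮ (z - w)⁻² dz`, which vanishes. Instead of differentiating under the
integral sign, a second-order expansion of `(z - w')⁻¹` is estimated directly. -/
theorem hasDerivAt_contourIntegral_inv_sub {w : ℂ} (hw : w ∈ Γ.supportᶜ) :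
    HasDerivAt (fun w => Γ.contourIntegral fun z => (z - w)⁻¹) 0 w := by
  obtain ⟨δ, hδ, hball⟩ := Metric.isOpen_iff.1 Γ.isOpen_compl_support w hw
  set L := ∫ t in Γ.a..Γ.b, ‖deriv Γ.γ t‖
  have hfar : ∀ z ∈ Γ.support, δ ≤ ‖z - w‖ := fun z hz => by
    by_contra! h
    exact hball (mem_ball_iff_norm.2 h) hz
  -- The curve is at distance at least `δ` from `w` and at least `δ / 2` from `w'`, so the remainder
  -- `(w' - w)² / ((z - w') (z - w)²)` is at most `2 / δ³ * ‖w' - w‖²`.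
  have hbound : ∀ w' ∈ Metric.ball w (δ / 2),
      ‖(Γ.contourIntegral fun z => (z - w')⁻¹) - Γ.contourIntegral fun z => (z - w)⁻¹‖ ≤
        (2 / δ ^ 3 * L) * ‖w' - w‖ ^ 2 := by
    intro w' hw'
    rw [mem_ball_iff_norm] at hw'
    have hfar' : ∀ z ∈ Γ.support, δ / 2 ≤ ‖z - w'‖ := fun z hz => by
      have h1 := hfar z hz
      have h2 : ‖z - w‖ ≤ ‖z - w'‖ + ‖w' - w‖ := by
        simpa using norm_add_le (z - w') (w' - w)
      linarith
    have hw'' : w' ∉ Γ.support := fun h => by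
      have := hfar' w' h
      simp only [sub_self, norm_zero] at this
      linarith
    -- The first-order term may be subtracted for free, because its contour integral is zero.
    have h1 := ((hasContourIntegral_inv_sub hw'').add
      ((hasContourIntegral_inv_sub hw).const_mul (-1))).add
      ((HasContourIntegral.inv_sub_pow hw 0).const_mul (-(w' - w)))
    have h2 := h1.2
    rw [← (hasContourIntegral_inv_sub hw'').2, ← (hasContourIntegral_inv_sub hw).2] at h2
    have h3 : (Γ.contourIntegral fun z => (z - w')⁻¹) - (Γ.contourIntegral fun z => (z - w)⁻¹) =
        Γ.contourIntegral fun z => (z - w')⁻¹ + -1 * (z - w)⁻¹ +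
          -(w' - w) * (z - w)⁻¹ ^ (0 + 2) := by
      rw [h2]; ring
    rw [h3]
    have h4 : 2 / δ ^ 3 * L * ‖w' - w‖ ^ 2 = (2 / δ ^ 3 * ‖w' - w‖ ^ 2) * L := by ring
    rw [h4]
    refine norm_contourIntegral_le fun z hz => ?_
    have hz := hfar z hz
    have hz' := hfar' z ‹_›
    have n1 : z - w ≠ 0 := norm_pos_iff.1 (by linarith)
    have n2 : z - w' ≠ 0 := norm_pos_iff.1 (by linarith)
    have h5 : (z - w')⁻¹ + -1 * (z - w)⁻¹ + -(w' - w) * (z - w)⁻¹ ^ (0 + 2) =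
        (w' - w) ^ 2 / ((z - w') * (z - w) ^ 2) := by
      rw [inv_pow]
      field_simp
      ring
    rw [h5, norm_div, norm_mul, norm_pow, norm_pow, div_le_iff₀ (by positivity)]
    have h6 : δ / 2 * δ ^ 2 ≤ ‖z - w'‖ * ‖z - w‖ ^ 2 := by gcongr
    calc ‖w' - w‖ ^ 2 = 2 / δ ^ 3 * ‖w' - w‖ ^ 2 * (δ / 2 * δ ^ 2) := by field_simp
      _ ≤ _ := by gcongr
  rw [hasDerivAt_iff_isLittleO]
  have hO : (fun w' => (Γ.contourIntegral fun z => (z - w')⁻¹) -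
      (Γ.contourIntegral fun z => (z - w)⁻¹) - (w' - w) • (0 : ℂ)) =O[nhds w]
        fun w' => ‖w' - w‖ ^ 2 := by
    refine Asymptotics.IsBigO.of_bound (2 / δ ^ 3 * L) ?_
    filter_upwards [Metric.ball_mem_nhds w (half_pos hδ)] with w' hw'
    simpa using hbound w' hw'
  refine hO.trans_isLittleO ?_
  have h7 := Asymptotics.isLittleO_norm_pow_id (E' := ℂ) one_lt_two
  have h8 : Filter.Tendsto (fun w' => w' - w) (nhds w) (nhds 0) :=
    (continuous_id.sub continuous_const).tendsto' _ _ (by simp)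
  exact h7.comp_tendsto h8

/-- The component of `w` is unbounded. The integral is constant on it, having zero derivative, and
it is arbitrarily small far from the curve. -/
theorem windingNumber_eq_zero {w : ℂ} (hw : w ∉ Γ.support) (hin : w ∉ Γ.inside) :
    Γ.windingNumber w = 0 := by
  set G : ℂ → ℂ := fun w => Γ.contourIntegral fun z => (z - w)⁻¹
  set V := connectedComponentIn Γ.supportᶜ w
  have hVsub : V ⊆ Γ.supportᶜ := connectedComponentIn_subset _ _
  have hVo : IsOpen V := Γ.isOpen_compl_support.connectedComponentIn
  have hVc : IsPreconnected V := isPreconnected_connectedComponentIn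
  have hwV : w ∈ V := mem_connectedComponentIn hw
  have hunb : ¬ Bornology.IsBounded V := fun h => hin ⟨hw, h⟩
  have hconst : ∀ w' ∈ V, G w' = G w := fun w' hw' =>
    hVo.is_const_of_deriv_eq_zero hVc
      (fun u hu => (hasDerivAt_contourIntegral_inv_sub
        (hVsub hu)).differentiableAt.differentiableWithinAt)
      (fun u hu => (hasDerivAt_contourIntegral_inv_sub (hVsub hu)).deriv) hw' hwV
  suffices hG : G w = 0 by
    rw [windingNumber]
    exact mul_eq_zero_of_right _ hG
  obtain ⟨R, hR⟩ := Γ.isCompact_support.isBounded.exists_norm_le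
  set L := ∫ t in Γ.a..Γ.b, ‖deriv Γ.γ t‖
  have hL : 0 ≤ L := intervalIntegral.integral_nonneg Γ.a_lt_b.le fun t _ => norm_nonneg _
  rw [← norm_le_zero_iff]
  refine le_of_forall_pos_le_add fun ε hε => ?_
  rw [zero_add]
  -- The curve lies in the disc of radius `R`, so such a `w'` is at distance at least `(L + 1) / ε`
  -- from it and the integral is at most `ε L / (L + 1)`. The `+ 1` keeps the quotient positive when
  -- `L = 0`.
  have hex : ∃ w' ∈ V, R + (L + 1) / ε < ‖w'‖ := by
    by_contra! h
    exact hunb (isBounded_iff_forall_norm_le.2 ⟨_, h⟩)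
  obtain ⟨w', hw'V, hw'⟩ := hex
  rw [← hconst w' hw'V]
  have hpos : 0 < (L + 1) / ε := by positivity
  have h1 : ‖G w'‖ ≤ (ε / (L + 1)) * L := norm_contourIntegral_le fun z hz => by
    have h2 : ‖w'‖ ≤ ‖z - w'‖ + ‖z‖ := by
      have := norm_sub_le z (z - w')
      rw [sub_sub_cancel] at this
      linarith
    have h3 := hR z hz
    rw [norm_inv, ← inv_div (L + 1) ε]
    exact inv_anti₀ hpos (by linarith)
  calc ‖G w'‖ ≤ (ε / (L + 1)) * L := h1
    _ ≤ (ε / (L + 1)) * (L + 1) := by gcongr; linarith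
    _ = ε := by field_simp

open Classical in
/-- The integral of `1 / (z - w)` along a positively oriented curve. -/
theorem PositivelyOriented.hasContourIntegral_inv_sub (hΓ : Γ.PositivelyOriented) {w : ℂ}
    (hw : w ∉ Γ.support) :
    Γ.HasContourIntegral (fun z => (z - w)⁻¹)
      (if w ∈ Γ.inside then 2 * Real.pi * Complex.I else 0) := by
  have h := SimpleClosedCurve.hasContourIntegral_inv_sub hw
  split_ifs with hin
  · simpa [hΓ w hin] using h
  · simpa [windingNumber_eq_zero hw hin] using h

end SimpleClosedCurve

/-! ### Block diagonal matrices -/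

section DiagBlocks

variable {p q n : ℕ} (h : p + q = n)

theorem diagBlocks_mul (X X' : Matrix (Fin p) (Fin p) ℂ) (Y Y' : Matrix (Fin q) (Fin q) ℂ) :
    diagBlocks h X Y * diagBlocks h X' Y' = diagBlocks h (X * X') (Y * Y') := by
  simp only [diagBlocks, Matrix.reindex_apply, Matrix.submatrix_mul_equiv,
    Matrix.fromBlocks_multiply, Matrix.mul_zero, Matrix.zero_mul, add_zero, zero_add]

theorem diagBlocks_one : diagBlocks h (1 : Matrix (Fin p) (Fin p) ℂ) 1 = 1 := by
  simp only [diagBlocks, Matrix.reindex_apply, Matrix.fromBlocks_one, Matrix.submatrix_one_equiv]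

theorem diagBlocks_sub (X X' : Matrix (Fin p) (Fin p) ℂ) (Y Y' : Matrix (Fin q) (Fin q) ℂ) :
    diagBlocks h X Y - diagBlocks h X' Y' = diagBlocks h (X - X') (Y - Y') := by
  subst h
  ext i j
  induction i using Fin.addCases <;> induction j using Fin.addCases <;> simp [diagBlocks]

theorem smul_diagBlocks (c : ℂ) (X : Matrix (Fin p) (Fin p) ℂ) (Y : Matrix (Fin q) (Fin q) ℂ) :
    c • diagBlocks h X Y = diagBlocks h (c • X) (c • Y) := by
  subst h
  ext i j
  induction i using Fin.addCases <;> induction j using Fin.addCases <;> simp [diagBlocks]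

theorem det_diagBlocks (X : Matrix (Fin p) (Fin p) ℂ) (Y : Matrix (Fin q) (Fin q) ℂ) :
    (diagBlocks h X Y).det = X.det * Y.det := by
  rw [diagBlocks, Matrix.det_reindex_self, Matrix.det_fromBlocks_zero₂₁]

end DiagBlocks

/-! ### Jordan matrices -/

section JordanMatrix

variable {m : ℕ} (k : Fin m → ℕ) (μ : Fin m → ℂ)

/-- The index of the Jordan block to which a row belongs. -/
noncomputable def blockIndex (a : Fin (∑ i, k i)) : Fin m := (finSigmaFinEquiv.symm a).1

/-- The nilpotent part is itself the Jordan matrix with all eigenvalues zero, so facts about it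
serve both `J` and `N`. -/
theorem jordanMatrix_eq_diagonal_add :
    jordanMatrix k μ =
      Matrix.diagonal (fun a => μ (blockIndex k a)) + jordanMatrix k (fun _ => 0) := by
  ext a b
  obtain ⟨⟨i, a⟩, rfl⟩ := finSigmaFinEquiv.surjective a
  obtain ⟨⟨j, b⟩, rfl⟩ := finSigmaFinEquiv.surjective b
  simp only [jordanMatrix, Matrix.reindex_apply, Matrix.submatrix_apply, Matrix.add_apply,
    Equiv.symm_apply_apply, Matrix.diagonal_apply, EmbeddingLike.apply_eq_iff_eq, blockIndex]
  by_cases hij : i = j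
  · subst hij
    by_cases hab : a = b
    · subst hab
      simp [Matrix.blockDiagonal'_apply_eq, jordanBlock]
    · simp [Matrix.blockDiagonal'_apply_eq, jordanBlock, hab]
  · simp [Matrix.blockDiagonal'_apply_ne _ _ _ hij, hij]

/-- The first conclusion yields triangularity and nilpotency; the second yields commutation with
diagonal matrices that are constant on blocks. -/
theorem jordanMatrix_zero_apply_ne_zero {a b : Fin (∑ i, k i)}
    (h : jordanMatrix k (fun _ => 0) a b ≠ 0) :
    (a : ℕ) + 1 = b ∧ blockIndex k a = blockIndex k b := by
  obtain ⟨⟨i, a⟩, rfl⟩ := finSigmaFinEquiv.surjective a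
  obtain ⟨⟨j, b⟩, rfl⟩ := finSigmaFinEquiv.surjective b
  simp only [jordanMatrix, Matrix.reindex_apply, Matrix.submatrix_apply,
    Equiv.symm_apply_apply, blockIndex] at h ⊢
  by_cases hij : i = j
  · subst hij
    rw [Matrix.blockDiagonal'_apply_eq] at h
    refine ⟨?_, rfl⟩
    have h2 : (a : ℕ) + 1 = b := by
      by_contra hab
      simp [jordanBlock, hab] at h
    simp only [finSigmaFinEquiv_apply]
    omega
  · exact absurd (Matrix.blockDiagonal'_apply_ne _ _ _ hij) h

/-- Each factor advances the index by exactly one; a shift by the full order leaves the matrix, so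
that power is zero. -/
theorem jordanMatrix_zero_pow_apply_ne_zero (r : ℕ) {a b : Fin (∑ i, k i)}
    (h : (jordanMatrix k (fun _ => 0) ^ r) a b ≠ 0) : (a : ℕ) + r = b := by
  induction r generalizing b with
  | zero =>
    by_contra hab
    refine h ?_
    rw [pow_zero, Matrix.one_apply_ne]
    rintro rfl
    exact hab rfl
  | succ r ih =>
    rw [pow_succ, Matrix.mul_apply] at h
    obtain ⟨c, -, hc⟩ := Finset.exists_ne_zero_of_sum_ne_zero h
    have h1 := ih (left_ne_zero_of_mul hc)
    have h2 := (jordanMatrix_zero_apply_ne_zero k (right_ne_zero_of_mul hc)).1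
    omega

theorem jordanMatrix_zero_pow_card : jordanMatrix k (fun _ => 0) ^ (∑ i, k i) = 0 := by
  ext a b
  by_contra h
  have := jordanMatrix_zero_pow_apply_ne_zero k _ h
  omega

theorem det_smul_one_sub_jordanMatrix (z : ℂ) :
    (z • (1 : Matrix _ _ ℂ) - jordanMatrix k μ).det = ∏ a, (z - μ (blockIndex k a)) := by
  have hN : ∀ a b, b ≤ a → jordanMatrix k (fun _ => 0) a b = 0 := fun a b hab => by
    by_contra h
    have := (jordanMatrix_zero_apply_ne_zero k h).1
    have : (b : ℕ) ≤ a := hab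
    omega
  rw [Matrix.det_of_isUpperTriangular]
  · refine Finset.prod_congr rfl fun a _ => ?_
    rw [jordanMatrix_eq_diagonal_add]
    simp [hN a a le_rfl]
  · intro a b hab
    rw [jordanMatrix_eq_diagonal_add]
    have hab' : b < a := hab
    simp [hN a b hab'.le, Matrix.one_apply_ne hab'.ne', Matrix.diagonal_apply_ne _ hab'.ne']

/-- Triangular with diagonal `-1`: the infinite eigenvalues contribute a nonzero constant, hence no
roots, to `det (zB - A)`. -/
theorem det_smul_jordanMatrix_zero_sub_one (z : ℂ) :
    (z • jordanMatrix k (fun _ => 0) - 1).det = (-1) ^ (∑ i, k i) := by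
  have hN : ∀ a b, b ≤ a → jordanMatrix k (fun _ => 0) a b = 0 := fun a b hab => by
    by_contra h
    have := (jordanMatrix_zero_apply_ne_zero k h).1
    have : (b : ℕ) ≤ a := hab
    omega
  rw [Matrix.det_of_isUpperTriangular]
  · simp [hN _ _ le_rfl]
  · intro a b hab
    have hab' : b < a := hab
    simp [hN a b hab'.le, Matrix.one_apply_ne hab'.ne']

theorem sum_castLE_eq_sum_filter (l : ℕ) (hl : l ≤ m) :
    ∑ i : Fin l, k (Fin.castLE hl i) =
      ∑ i ∈ Finset.univ.filter (fun i : Fin m => (i : ℕ) < l), k i := by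
  refine Finset.sum_bij (fun i _ => Fin.castLE hl i) (by simp)
    (fun _ _ _ _ h => Fin.castLE_injective hl h) (fun i hi => ?_) (fun _ _ => rfl)
  exact ⟨⟨i, (Finset.mem_filter.1 hi).2⟩, Finset.mem_univ _, rfl⟩

/-- Blocks occupy consecutive indices, so the ordering condition on blocks becomes a condition on
coordinates, in which `s` appears. -/
theorem blockIndex_lt_iff (l : ℕ) (a : Fin (∑ i, k i)) :
    (blockIndex k a : ℕ) < l ↔
      (a : ℕ) < ∑ i ∈ Finset.univ.filter (fun i : Fin m => (i : ℕ) < l), k i := by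
  obtain ⟨⟨i, a⟩, rfl⟩ := finSigmaFinEquiv.surjective a
  rw [finSigmaFinEquiv_apply, sum_castLE_eq_sum_filter]
  simp only [blockIndex, Equiv.symm_apply_apply]
  have ha := a.2
  constructor
  · intro hil
    have hnot : i ∉ Finset.univ.filter (fun j : Fin m => (j : ℕ) < i) := by simp
    have h1 : ∑ j ∈ insert i (Finset.univ.filter (fun j : Fin m => (j : ℕ) < i)), k j ≤
        ∑ j ∈ Finset.univ.filter (fun j : Fin m => (j : ℕ) < l), k j := by
      refine Finset.sum_le_sum_of_subset fun j hj => ?_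
      simp only [Finset.mem_insert, Finset.mem_filter, Finset.mem_univ, true_and] at hj ⊢
      rcases hj with rfl | hj <;> omega
    rw [Finset.sum_insert hnot] at h1
    omega
  · intro h
    by_contra! hli
    have h1 : ∑ j ∈ Finset.univ.filter (fun j : Fin m => (j : ℕ) < l), k j ≤
        ∑ j ∈ Finset.univ.filter (fun j : Fin m => (j : ℕ) < i), k j := by
      refine Finset.sum_le_sum_of_subset fun j hj => ?_
      simp only [Finset.mem_filter, Finset.mem_univ, true_and] at hj ⊢
      omega
    omega

/-- The resolvent of a Jordan matrix. -/
theorem inv_smul_one_sub_jordanMatrix {z : ℂ} (hz : ∀ a, z ≠ μ (blockIndex k a)) :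
    (z • (1 : Matrix _ _ ℂ) - jordanMatrix k μ)⁻¹ = ∑ r ∈ Finset.range (∑ i, k i),
      Matrix.diagonal (fun a => ((z - μ (blockIndex k a))⁻¹) ^ (r + 1)) *
        jordanMatrix k (fun _ => 0) ^ r := by
  set N := jordanMatrix k (fun _ => 0) with hN
  set D := Matrix.diagonal (fun a => z - μ (blockIndex k a)) with hD
  set P := Matrix.diagonal (fun a => (z - μ (blockIndex k a))⁻¹) with hP
  have hDP : D * P = 1 := by
    rw [hD, hP, Matrix.diagonal_mul_diagonal, ← Matrix.diagonal_one]
    congr 1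
    ext a
    exact mul_inv_cancel₀ (sub_ne_zero.2 (hz a))
  -- `P` is constant on each block and `N` has no entry linking two blocks.
  have hPN : Commute P N := by
    ext a b
    rw [hP, Matrix.diagonal_mul, Matrix.mul_diagonal]
    by_cases h : N a b = 0
    · simp [h]
    · rw [(jordanMatrix_zero_apply_ne_zero k h).2, mul_comm]
  have hM : z • (1 : Matrix _ _ ℂ) - jordanMatrix k μ = D - N := by
    rw [jordanMatrix_eq_diagonal_add, ← sub_sub, hD]
    congr 1
    ext a b
    by_cases hab : a = b
    · subst hab; simp
    · simp [hab]
  have hterm : ∀ r, Matrix.diagonal (fun a => ((z - μ (blockIndex k a))⁻¹) ^ (r + 1)) * N ^ r =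
      P * (P * N) ^ r := fun r => by
    rw [hPN.mul_pow, ← mul_assoc, ← pow_succ', hP, Matrix.diagonal_pow]
    rfl
  refine Matrix.inv_eq_right_inv ?_
  simp only [hterm, ← Finset.mul_sum]
  -- The inverse is the Neumann series for `1 - P * N` followed by `P = D⁻¹`. It is finite because
  -- `(P * N) ^ r = P ^ r * N ^ r` vanishes when `r` is the order.
  have hDN : D - N = D * (1 - P * N) := by
    rw [mul_sub, mul_one, ← mul_assoc, hDP, one_mul]
  have hcomm : (1 - P * N) * P = P * (1 - P * N) := by
    rw [sub_mul, mul_sub, one_mul, mul_one, mul_assoc, ← hPN.eq]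
  rw [hM, hDN, mul_assoc, ← mul_assoc (1 - P * N), hcomm, mul_assoc P, mul_neg_geom_sum,
    ← mul_assoc, hDP, one_mul, hPN.mul_pow, jordanMatrix_zero_pow_card, mul_zero, sub_zero]

/-- A geometric series cut off by nilpotency. It is a polynomial in `z`, so its integral along any
closed curve vanishes. -/
theorem inv_smul_jordanMatrix_zero_sub_one (z : ℂ) :
    (z • jordanMatrix k (fun _ => 0) - 1)⁻¹ = ∑ r ∈ Finset.range (∑ i, k i),
      (-z ^ r) • jordanMatrix k (fun _ => 0) ^ r := by
  refine Matrix.inv_eq_right_inv ?_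
  have hterm : ∀ r, (-z ^ r) • jordanMatrix k (fun _ => 0) ^ r =
      -((z • jordanMatrix k (fun _ => 0)) ^ r) := fun r => by
    rw [smul_pow, neg_smul]
  simp only [hterm, Finset.sum_neg_distrib]
  rw [mul_neg, ← neg_mul, neg_sub, mul_neg_geom_sum, smul_pow, jordanMatrix_zero_pow_card,
    smul_zero, sub_zero]

end JordanMatrix

/-! ### Contour integrals of matrices -/

namespace SimpleClosedCurve

variable {Γ : SimpleClosedCurve}

variable (Γ) in
/-- The contour integral of the matrix function `F`, taken entry by entry, has the value `V`. -/
def HasMatrixContourIntegral {ι κ : Type*} (F : ℂ → Matrix ι κ ℂ) (V : Matrix ι κ ℂ) : Prop :=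
  ∀ i j, Γ.HasContourIntegral (fun z => F z i j) (V i j)

namespace HasMatrixContourIntegral

variable {ι κ τ : Type*} {F G : ℂ → Matrix ι κ ℂ} {V : Matrix ι κ ℂ}

theorem congr (hF : Γ.HasMatrixContourIntegral F V) (h : ∀ z ∈ Γ.support, F z = G z) :
    Γ.HasMatrixContourIntegral G V :=
  fun i j => (hF i j).congr fun z hz => by rw [h z hz]

theorem const_mul [Fintype ι] (M : Matrix τ ι ℂ) (hF : Γ.HasMatrixContourIntegral F V) :
    Γ.HasMatrixContourIntegral (fun z => M * F z) (M * V) := fun i j => by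
  simp only [Matrix.mul_apply]
  exact HasContourIntegral.sum _ fun a _ => (hF a j).const_mul _

theorem mul_const [Fintype κ] (M : Matrix κ τ ℂ) (hF : Γ.HasMatrixContourIntegral F V) :
    Γ.HasMatrixContourIntegral (fun z => F z * M) (V * M) := fun i j => by
  simp only [Matrix.mul_apply]
  exact HasContourIntegral.sum _ fun a _ => (hF i a).mul_const _

theorem sum {σ : Type*} (s : Finset σ) {F : σ → ℂ → Matrix ι κ ℂ} {V : σ → Matrix ι κ ℂ}
    (h : ∀ r ∈ s, Γ.HasMatrixContourIntegral (F r) (V r)) :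
    Γ.HasMatrixContourIntegral (fun z => ∑ r ∈ s, F r z) (∑ r ∈ s, V r) := fun i j => by
  simp only [Matrix.sum_apply]
  exact HasContourIntegral.sum _ fun r hr => h r hr i j

theorem smul_const {f : ℂ → ℂ} {v : ℂ} (hf : Γ.HasContourIntegral f v) (M : Matrix ι κ ℂ) :
    Γ.HasMatrixContourIntegral (fun z => f z • M) (v • M) := fun i j => by
  simpa using hf.mul_const (M i j)

theorem diagonal [DecidableEq ι] {f : ι → ℂ → ℂ} {v : ι → ℂ}
    (hf : ∀ i, Γ.HasContourIntegral (f i) (v i)) :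
    Γ.HasMatrixContourIntegral (fun z => Matrix.diagonal fun i => f i z) (Matrix.diagonal v) :=
  fun i j => by
    by_cases h : i = j
    · subst h
      simpa using hf i
    · simpa [h] using HasContourIntegral.zero

theorem diagBlocks {p q n : ℕ} (h : p + q = n) {X : ℂ → Matrix (Fin p) (Fin p) ℂ}
    {Y : ℂ → Matrix (Fin q) (Fin q) ℂ} {X₀ : Matrix (Fin p) (Fin p) ℂ}
    {Y₀ : Matrix (Fin q) (Fin q) ℂ} (hX : Γ.HasMatrixContourIntegral X X₀)
    (hY : Γ.HasMatrixContourIntegral Y Y₀) :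
    Γ.HasMatrixContourIntegral (fun z => _root_.diagBlocks h (X z) (Y z))
      (_root_.diagBlocks h X₀ Y₀) := by
  subst h
  intro i j
  induction i using Fin.addCases with
  | left i =>
    induction j using Fin.addCases with
    | left j => simpa [_root_.diagBlocks] using hX i j
    | right j => simpa [_root_.diagBlocks] using HasContourIntegral.zero
  | right i =>
    induction j using Fin.addCases with
    | left j => simpa [_root_.diagBlocks] using HasContourIntegral.zero
    | right j => simpa [_root_.diagBlocks] using hY i j

end HasMatrixContourIntegral

-- Only the term `r = 0` of the Neumann series survives: entries with higher powers of `(z - λ)⁻¹`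
-- have a primitive.
open Classical in
theorem PositivelyOriented.hasMatrixContourIntegral_inv_jordanMatrix (hΓ : Γ.PositivelyOriented)
    {m : ℕ} (k : Fin m → ℕ) (μ : Fin m → ℂ) (hμ : ∀ a, μ (blockIndex k a) ∉ Γ.support) :
    Γ.HasMatrixContourIntegral (fun z => (z • (1 : Matrix _ _ ℂ) - jordanMatrix k μ)⁻¹)
      ((2 * Real.pi * Complex.I) •
        Matrix.diagonal fun a => if μ (blockIndex k a) ∈ Γ.inside then (1 : ℂ) else 0) := by
  have hterm : ∀ r, Γ.HasMatrixContourIntegral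
      (fun z => Matrix.diagonal (fun a => ((z - μ (blockIndex k a))⁻¹) ^ (r + 1)) *
        jordanMatrix k (fun _ => 0) ^ r)
      (if r = 0 then (2 * Real.pi * Complex.I) •
        Matrix.diagonal fun a => if μ (blockIndex k a) ∈ Γ.inside then (1 : ℂ) else 0 else 0) := by
    rintro (_ | r)
    · have h := HasMatrixContourIntegral.diagonal fun a => hΓ.hasContourIntegral_inv_sub (hμ a)
      simp only [zero_add, pow_one, pow_zero, mul_one, if_true]
      convert h using 1
      ext a b
      by_cases hab : a = b
      · subst hab; simp
      · simp [hab]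
    · have h := (HasMatrixContourIntegral.diagonal fun a =>
        HasContourIntegral.inv_sub_pow (hμ a) r).mul_const (jordanMatrix k (fun _ => 0) ^ (r + 1))
      simpa using h
  have h := HasMatrixContourIntegral.sum (Finset.range (∑ i, k i)) fun r _ => hterm r
  have hsum : (∑ r ∈ Finset.range (∑ i, k i), if r = 0 then (2 * Real.pi * Complex.I) •
      Matrix.diagonal (fun a => if μ (blockIndex k a) ∈ Γ.inside then (1 : ℂ) else 0) else 0) =
      (2 * Real.pi * Complex.I) •
        Matrix.diagonal fun a => if μ (blockIndex k a) ∈ Γ.inside then (1 : ℂ) else 0 := by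
    rw [Finset.sum_ite_eq']
    split_ifs with h0
    · rfl
    -- The sum lacks its term `r = 0` only for matrices of order zero, which have no entries.
    · ext a
      exact absurd (Finset.mem_range.2 (Nat.zero_lt_of_lt a.2)) h0
  rw [hsum] at h
  refine h.congr fun z hz => (inv_smul_one_sub_jordanMatrix k μ fun a ha => hμ a ?_).symm
  exact ha ▸ hz

theorem hasMatrixContourIntegral_inv_jordanMatrix_zero {m : ℕ} (k : Fin m → ℕ) :
    Γ.HasMatrixContourIntegral (fun z => (z • jordanMatrix k (fun _ => 0) - 1)⁻¹) 0 := by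
  have h := HasMatrixContourIntegral.sum (Γ := Γ) (Finset.range (∑ i, k i)) fun r _ =>
    HasMatrixContourIntegral.smul_const ((HasContourIntegral.pow (Γ := Γ) r).const_mul (-1))
      (jordanMatrix k (fun _ => 0) ^ r)
  simp only [mul_zero, zero_smul, Finset.sum_const_zero, neg_one_mul] at h
  exact h.congr fun z _ => (inv_smul_jordanMatrix_zero_sub_one k z).symm

end SimpleClosedCurve

/-! ### Jordan bases -/

section JordanBasis

-- The basis is `(X - μ) ^ (k - 1 - a)`. Multiplication by `X - μ` raises the exponent, so it lowers
-- `a` by one and kills the vector with `a = 0`; the reversed order makes the block upper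
-- triangular. The ideal is kept as a variable so that it can be given by another generator.
open Polynomial in
theorem exists_jordan_basis_quotient (μ : ℂ) (k : ℕ) (I : Ideal ℂ[X])
    (hI : I = Ideal.span {(X - C μ) ^ k}) :
    ∃ b : Module.Basis (Fin k) ℂ (ℂ[X] ⧸ I), ∀ a : Fin k,
      (X : ℂ[X]) • b a = μ • b a +
        if h : 0 < (a : ℕ) then b ⟨a - 1, by omega⟩ else 0 := by
  subst hI
  set I := Ideal.span {(X - C μ) ^ k}
  let v : Fin k → ℂ[X] ⧸ I := fun a => Submodule.Quotient.mk ((X - C μ) ^ (k - 1 - (a : ℕ)))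
  have hzero : ∀ r, k ≤ r → (Submodule.Quotient.mk ((X - C μ) ^ r) : ℂ[X] ⧸ I) = 0 := fun r hr =>
    (Submodule.Quotient.mk_eq_zero _).2
      (Ideal.mem_span_singleton.2 (pow_dvd_pow _ hr))
  have hspan : ⊤ ≤ Submodule.span ℂ (Set.range v) := by
    rintro x -
    obtain ⟨f, rfl⟩ := Submodule.Quotient.mk_surjective _ x
    -- The Taylor expansion at `μ` writes `f` in powers of `X - μ`, and those of exponent at least
    -- `k` die in the quotient.
    rw [← Polynomial.sum_taylor_eq f μ, Polynomial.sum_def]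
    change I.mkQ _ ∈ _
    rw [map_sum]
    refine Submodule.sum_mem _ fun r _ => ?_
    rw [← Polynomial.smul_eq_C_mul]
    change Submodule.Quotient.mk (_ • _) ∈ _
    rw [Submodule.Quotient.mk_smul]
    refine Submodule.smul_mem _ _ ?_
    by_cases hr : k ≤ r
    · rw [hzero r hr]
      exact Submodule.zero_mem _
    · refine Submodule.subset_span ⟨⟨k - 1 - r, by omega⟩, ?_⟩
      have : k - 1 - (k - 1 - r) = r := by omega
      simp only [v, this]
  have hcard : Fintype.card (Fin k) = Module.finrank ℂ (ℂ[X] ⧸ I) := by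
    rw [finrank_quotient_span_eq_natDegree, Polynomial.natDegree_pow,
      Polynomial.natDegree_X_sub_C, Fintype.card_fin, mul_one]
  refine ⟨basisOfTopLeSpanOfCardEqFinrank v hspan hcard, fun a => ?_⟩
  rw [coe_basisOfTopLeSpanOfCardEqFinrank]
  have hX : (X : ℂ[X]) • v a = μ • v a +
      Submodule.Quotient.mk ((X - C μ) ^ (k - 1 - (a : ℕ) + 1)) := by
    simp only [v, ← Submodule.Quotient.mk_smul, ← Submodule.Quotient.mk_add]
    congr 1
    rw [smul_eq_mul, Polynomial.smul_eq_C_mul]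
    ring
  rw [hX]
  congr 1
  split_ifs with h
  · have : k - 1 - (a : ℕ) + 1 = k - 1 - ((a : ℕ) - 1) := by omega
    simp only [v, this]
  · exact hzero _ (by omega)

theorem Polynomial.span_singleton_pow_eq_of_irreducible {p : Polynomial ℂ} (hp : Irreducible p) :
    ∃ μ : ℂ, ∀ e : ℕ, Ideal.span {p ^ e} = Ideal.span {(Polynomial.X - Polynomial.C μ) ^ e} := by
  obtain ⟨μ, hμ⟩ := IsAlgClosed.exists_root p
    (by rw [IsAlgClosed.degree_eq_one_of_irreducible ℂ hp]; exact one_ne_zero)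
  refine ⟨μ, fun e => Ideal.span_singleton_eq_span_singleton.2 (Associated.pow_pow ?_)⟩
  exact ((Polynomial.irreducible_X_sub_C μ).associated_of_dvd hp
    (Polynomial.dvd_iff_isRoot.2 hμ)).symm

variable {V : Type*} [AddCommGroup V] [Module ℂ V] [FiniteDimensional ℂ V]

/-- Every endomorphism of a finite-dimensional complex vector space has a Jordan basis. -/
theorem exists_jordan_basis (f : Module.End ℂ V) :
    ∃ (ι : Type) (_ : Fintype ι) (k : ι → ℕ) (μ : ι → ℂ)
      (b : Module.Basis (Σ i, Fin (k i)) ℂ V), (∀ i, 0 < k i) ∧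
      ∀ (i : ι) (a : Fin (k i)), f (b ⟨i, a⟩) = μ i • b ⟨i, a⟩ +
        if h : 0 < (a : ℕ) then b ⟨i, ⟨a - 1, by omega⟩⟩ else 0 := by
  classical
  -- With `X` acting as `f`, `V` is a finitely generated torsion `ℂ[X]`-module, hence a direct sum
  -- of quotients by prime powers; over `ℂ` the primes are linear.
  obtain ⟨ι, _, p, hp, e, ⟨φ⟩⟩ := Module.equiv_directSum_of_isTorsion
    (Module.AEval.isTorsion_of_finiteDimensional ℂ V f)
  choose μ hμ using fun i => Polynomial.span_singleton_pow_eq_of_irreducible (hp i)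
  choose c hc using fun i => exists_jordan_basis_quotient (μ i) (e i) _ (hμ i (e i))
  let ψ : V ≃ₗ[ℂ] DirectSum ι fun i => Polynomial ℂ ⧸ Ideal.span {p i ^ e i} :=
    (Module.AEval.of ℂ V f).trans (φ.restrictScalars ℂ)
  have hψ : ∀ v, ψ (f v) = (Polynomial.X : Polynomial ℂ) • ψ v := fun v => by
    change φ (Module.AEval.of ℂ V f (f • v)) = _ • φ _
    rw [← Module.AEval.X_smul_of, map_smul]
    rfl
  let b : Module.Basis (Σ i, Fin (e i)) ℂ V := (DFinsupp.basis c).map ψ.symm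
  have hψb : ∀ i a, ψ (b ⟨i, a⟩) = DirectSum.lof (Polynomial ℂ) ι _ i (c i a) := fun i a => by
    simp only [b, Module.Basis.map_apply, LinearEquiv.apply_symm_apply]
    have h : DFinsupp.basis c ⟨i, a⟩ = DFinsupp.single i (c i a) := by
      rw [← Module.Basis.repr_symm_single_one]
      simp [DFinsupp.basis]
    exact h
  have hb : ∀ (i : ι) (a : Fin (e i)), f (b ⟨i, a⟩) = μ i • b ⟨i, a⟩ +
      if h : 0 < (a : ℕ) then b ⟨i, ⟨a - 1, by omega⟩⟩ else 0 := fun i a => by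
    apply ψ.injective
    rw [hψ, map_add, map_smul, hψb, ← map_smul, hc, map_add]
    congr 1
    · exact LinearMap.map_smul_of_tower _ (μ i) (c i a)
    · split_ifs with h
      · rw [hψb]
      · simp
  -- The structure theorem permits zero exponents. Such summands carry no basis vectors, so
  -- discarding them only reindexes the basis and makes all block sizes positive.
  let σ : (Σ i : {i // 0 < e i}, Fin (e i)) ≃ Σ i, Fin (e i) :=
    { toFun := fun x => ⟨x.1, x.2⟩
      invFun := fun x => ⟨⟨x.1, Nat.zero_lt_of_lt x.2.2⟩, x.2⟩
      left_inv := fun _ => rfl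
      right_inv := fun _ => rfl }
  refine ⟨{i // 0 < e i}, inferInstance, fun i => e i, fun i => μ i, b.reindex σ.symm,
    fun i => i.2, fun i a => ?_⟩
  simp only [Module.Basis.reindex_apply, Equiv.symm_symm]
  exact hb i a

theorem exists_equiv_fin_of_pred {ι : Type*} [Fintype ι] (P : ι → Prop) :
    ∃ (m l : ℕ) (σ : ι ≃ Fin m), l ≤ m ∧ ∀ i, P i ↔ (σ i : ℕ) < l := by
  classical
  refine ⟨Fintype.card {i // P i} + Fintype.card {i // ¬ P i}, Fintype.card {i // P i},
    (Equiv.sumCompl P).symm.trans (((Fintype.equivFin _).sumCongr (Fintype.equivFin _)).trans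
      finSumFinEquiv), Nat.le_add_right _ _, fun i => ?_⟩
  by_cases hi : P i
  · simp [Equiv.sumCompl_symm_apply_of_pos hi, hi]
  · simp [Equiv.sumCompl_symm_apply_of_neg hi, hi]

/-- Every endomorphism of a finite-dimensional complex vector space is represented by a matrix in
Jordan canonical form, where the blocks whose eigenvalue satisfies `P` come first. -/
theorem exists_basis_toMatrix_eq_jordanMatrix (f : Module.End ℂ V) (P : ℂ → Prop) :
    ∃ (m l : ℕ) (k : Fin m → ℕ) (μ : Fin m → ℂ)
      (b : Module.Basis (Fin (∑ i, k i)) ℂ V), (∀ i, 0 < k i) ∧ l ≤ m ∧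
      (∀ i, P (μ i) ↔ (i : ℕ) < l) ∧ LinearMap.toMatrix b b f = jordanMatrix k μ ∧
      ∀ i, f.HasEigenvalue (μ i) := by
  obtain ⟨ι, _, k, μ, b, hk, hb⟩ := exists_jordan_basis f
  obtain ⟨m, l, σ, hl, hσ⟩ := exists_equiv_fin_of_pred fun i => P (μ i)
  let τ : (Σ i : Fin m, Fin (k (σ.symm i))) ≃ Σ i, Fin (k i) :=
    Equiv.sigmaCongrLeft (β := fun i => Fin (k i)) σ.symm
  let b' : Module.Basis (Σ i : Fin m, Fin (k (σ.symm i))) ℂ V := b.reindex τ.symm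
  have hb' : ∀ (i : Fin m) (a : Fin (k (σ.symm i))), f (b' ⟨i, a⟩) =
      μ (σ.symm i) • b' ⟨i, a⟩ + if h : 0 < (a : ℕ) then b' ⟨i, ⟨a - 1, by omega⟩⟩ else 0 :=
    fun i a => by
      simp only [b', Module.Basis.reindex_apply, Equiv.symm_symm]
      exact hb (σ.symm i) a
  refine ⟨m, l, fun i => k (σ.symm i), fun i => μ (σ.symm i), b'.reindex finSigmaFinEquiv,
    fun i => hk _, hl, fun i => by simp [hσ], ?_, fun i => ?_⟩
  · ext x y
    obtain ⟨⟨i, a⟩, rfl⟩ := finSigmaFinEquiv.surjective x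
    obtain ⟨⟨j, c⟩, rfl⟩ := finSigmaFinEquiv.surjective y
    rw [LinearMap.toMatrix_apply, Module.Basis.reindex_apply, Equiv.symm_apply_apply, hb',
      Module.Basis.repr_reindex_apply, Equiv.symm_apply_apply]
    simp only [jordanMatrix, Matrix.reindex_apply, Matrix.submatrix_apply, Equiv.symm_apply_apply]
    by_cases hij : i = j
    · subst hij
      rw [Matrix.blockDiagonal'_apply_eq]
      by_cases hac : a = c
      · subst hac
        split_ifs with h
        · have hne : (⟨(a : ℕ) - 1, by omega⟩ : Fin (k (σ.symm i))) ≠ a := fun h' => by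
            have := congrArg Fin.val h'
            simp only at this
            omega
          simp [jordanBlock, hne]
        · simp [jordanBlock]
      · have hca : c ≠ a := fun h => hac h.symm
        split_ifs with h
        · have hiff : (⟨(c : ℕ) - 1, by omega⟩ : Fin (k (σ.symm i))) = a ↔ (a : ℕ) + 1 = c := by
            rw [Fin.ext_iff]
            simp only
            omega
          simp [jordanBlock, Finsupp.single_apply, hac, hiff]
        · have hne : ¬ (a : ℕ) + 1 = c := by omega
          simp [jordanBlock, hac, hne]
    · rw [Matrix.blockDiagonal'_apply_ne _ _ _ hij]
      have hji : j ≠ i := fun h => hij h.symm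
      split_ifs with h <;> simp [hji]
  -- The first vector of each block is an eigenvector.
  · refine Module.End.hasEigenvalue_of_hasEigenvector
      (x := b' ⟨i, ⟨0, hk _⟩⟩) ⟨Module.End.mem_eigenspace_iff.2 ?_, b'.ne_zero _⟩
    rw [hb']
    simp

end JordanBasis

/-! ### The Weierstrass canonical form -/

section Weierstrass

variable {n : ℕ}

/-- Take `y = (z x - 1)⁻¹ x`, a product of commuting factors, one of them nilpotent. With `x` the
nilpotent part of `(zB - A)⁻¹ B`, this `y` is the block `N` of the pencil. -/
theorem exists_isNilpotent_mul_eq {R : Type*} [Ring R] [Algebra ℂ R] {x : R} (hx : IsNilpotent x)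
    (z : ℂ) : ∃ y, IsNilpotent y ∧ (z • x - 1) * y = x := by
  obtain ⟨u, hu⟩ : IsUnit (z • x - 1) := (hx.smul z).isUnit_sub_one
  have hcomm : Commute (↑u⁻¹ : R) x := by
    refine Commute.units_inv_left ?_
    rw [hu]
    exact ((Commute.refl x).smul_left z).sub_left (Commute.one_left x)
  exact ⟨↑u⁻¹ * x, hcomm.isNilpotent_mul_left hx, by rw [← hu, Units.mul_inv_cancel_left]⟩

/-- The deflating subspaces of a regular pencil for its finite and infinite eigenvalues. -/
theorem IsRegularPencil.exists_deflating {A B : Matrix (Fin n) (Fin n) ℂ}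
    (h : IsRegularPencil A B) :
    ∃ (R K : Submodule ℂ (Fin n → ℂ)) (_ : IsCompl R K) (J : Module.End ℂ R)
      (N : Module.End ℂ K), IsNilpotent N ∧
      (∀ v : R, A *ᵥ (v : Fin n → ℂ) = B *ᵥ (J v : Fin n → ℂ)) ∧
      ∀ v : K, B *ᵥ (v : Fin n → ℂ) = A *ᵥ (N v : Fin n → ℂ) := by
  obtain ⟨z, hz⟩ := h
  set G := z • B - A with hG
  have hGu : IsUnit G.det := hz.isUnit
  -- The infinite eigenvalue of the pencil is the eigenvalue 0 of `M`. Since `B = G M` and `A = G (z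
  -- M - 1)`, the required relations become `z M - 1 = M J` on the range and `M = (z M - 1) N` on
  -- the kernel of a high power of `M`.
  let M : Module.End ℂ (Fin n → ℂ) := (G⁻¹ * B).mulVecLin
  have hGM : ∀ v, G *ᵥ (M v) = B *ᵥ v := fun v => by
    simp only [M, Matrix.mulVecLin_apply, Matrix.mulVec_mulVec, ← Matrix.mul_assoc,
      Matrix.mul_nonsing_inv _ hGu, Matrix.one_mul]
  have hA : ∀ v, A *ᵥ v = z • (B *ᵥ v) - G *ᵥ v := fun v => by
    rw [hG, Matrix.sub_mulVec, Matrix.smul_mulVec, sub_sub_cancel]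
  -- `1 ≤ k` ensures `ker M ≤ ker (M ^ k)`, which makes `M` injective on the complementary range.
  obtain ⟨k, hk1, hk⟩ := ((Filter.eventually_ge_atTop 1).and
    (LinearMap.eventually_isCompl_ker_pow_range_pow M)).exists
  have hKinv : ∀ v ∈ LinearMap.ker (M ^ k), M v ∈ LinearMap.ker (M ^ k) := fun v hv => by
    rw [LinearMap.mem_ker] at hv ⊢
    rw [← Module.End.mul_apply, (Commute.pow_self M k).eq, Module.End.mul_apply, hv, map_zero]
  have hRinv : ∀ v ∈ LinearMap.range (M ^ k), M v ∈ LinearMap.range (M ^ k) := by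
    rintro _ ⟨v, rfl⟩
    exact ⟨M v, by rw [← Module.End.mul_apply, (Commute.pow_self M k).eq, Module.End.mul_apply]⟩
  let MK : Module.End ℂ (LinearMap.ker (M ^ k)) := M.restrict hKinv
  let MR : Module.End ℂ (LinearMap.range (M ^ k)) := M.restrict hRinv
  have hMKpow : ∀ r v, (((MK ^ r) v : LinearMap.ker (M ^ k)) : Fin n → ℂ) = (M ^ r) v := by
    intro r
    induction r with
    | zero => exact fun _ => rfl
    | succ r ih =>
      intro v
      rw [pow_succ, pow_succ, Module.End.mul_apply, Module.End.mul_apply, ih]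
      rfl
  have hMK : IsNilpotent MK := ⟨k, LinearMap.ext fun v => Subtype.ext ((hMKpow k v).trans v.2)⟩
  have hMR : Function.Injective MR := by
    rw [← LinearMap.ker_eq_bot, LinearMap.ker_eq_bot']
    intro v hv
    have h1 : M (v : Fin n → ℂ) = 0 := congrArg Subtype.val hv
    have h2 : (v : Fin n → ℂ) ∈ LinearMap.ker (M ^ k) := by
      obtain ⟨r, hr⟩ := Nat.exists_eq_add_of_le' hk1
      have h3 : M ^ k = M ^ r * M := by rw [hr, pow_succ]
      rw [LinearMap.mem_ker]
      exact (LinearMap.congr_fun h3 _).trans (by rw [Module.End.mul_apply, h1, map_zero])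
    exact Subtype.ext ((Submodule.disjoint_def.1 hk.disjoint) _ h2 v.2)
  let MR' : LinearMap.range (M ^ k) ≃ₗ[ℂ] LinearMap.range (M ^ k) :=
    LinearEquiv.ofInjectiveEndo MR hMR
  have hMR' : ∀ v, M (MR'.symm v : Fin n → ℂ) = v := fun v =>
    congrArg Subtype.val (MR'.apply_symm_apply v)
  obtain ⟨N, hN, hNeq⟩ := exists_isNilpotent_mul_eq (R := Module.End ℂ (LinearMap.ker (M ^ k))) hMK z
  refine ⟨LinearMap.range (M ^ k), LinearMap.ker (M ^ k), hk.symm,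
    -- `J = z - M⁻¹` solves `z M - 1 = M J` where `M` is invertible.
    z • 1 - MR'.symm.toLinearMap, N, hN, fun v => ?_, fun v => ?_⟩
  · have h1 : (((z • 1 - MR'.symm.toLinearMap : Module.End ℂ _) v : LinearMap.range (M ^ k)) :
        Fin n → ℂ) = z • (v : Fin n → ℂ) - (MR'.symm v : Fin n → ℂ) := rfl
    rw [h1, Matrix.mulVec_sub, Matrix.mulVec_smul, hA, ← hGM (MR'.symm v : Fin n → ℂ), hMR']
  · have h1 : (z • MK - 1 : Module.End ℂ _) (N v) = MK v := LinearMap.congr_fun hNeq v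
    have h2 : z • M (N v : Fin n → ℂ) - (N v : Fin n → ℂ) = M (v : Fin n → ℂ) :=
      congrArg Subtype.val h1
    rw [hA, ← hGM (N v : Fin n → ℂ), ← Matrix.mulVec_smul, ← Matrix.mulVec_sub, h2, hGM]

/-- The square matrix `[X Y]`. -/
noncomputable def joinCols {p q : ℕ} (h : p + q = n) (X : Matrix (Fin n) (Fin p) ℂ)
    (Y : Matrix (Fin n) (Fin q) ℂ) : Matrix (Fin n) (Fin n) ℂ :=
  (Matrix.fromCols X Y).submatrix (Equiv.refl _) (finSumFinEquiv.trans (finCongr h)).symm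

theorem mul_joinCols {p q : ℕ} (h : p + q = n) (M : Matrix (Fin n) (Fin n) ℂ)
    (X : Matrix (Fin n) (Fin p) ℂ) (Y : Matrix (Fin n) (Fin q) ℂ) :
    M * joinCols h X Y = joinCols h (M * X) (M * Y) := by
  rw [joinCols, joinCols, ← Matrix.mul_fromCols]
  rfl

theorem joinCols_mul_diagBlocks {p q : ℕ} (h : p + q = n) (X : Matrix (Fin n) (Fin p) ℂ)
    (Y : Matrix (Fin n) (Fin q) ℂ) (X' : Matrix (Fin p) (Fin p) ℂ)
    (Y' : Matrix (Fin q) (Fin q) ℂ) :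
    joinCols h X Y * diagBlocks h X' Y' = joinCols h (X * X') (Y * Y') := by
  rw [joinCols, joinCols, diagBlocks, Matrix.reindex_apply, Matrix.submatrix_mul_equiv,
    Matrix.fromCols_mul_fromBlocks, Matrix.mul_zero, Matrix.mul_zero, add_zero, zero_add]

/-- The matrix whose columns are the members of a basis of a subspace. -/
noncomputable def subspaceCols {p : ℕ} {U : Submodule ℂ (Fin n → ℂ)} (b : Module.Basis (Fin p) ℂ U) :
    Matrix (Fin n) (Fin p) ℂ := Matrix.of fun i j => (b j : Fin n → ℂ) i

theorem mul_subspaceCols_eq {p : ℕ} {U : Submodule ℂ (Fin n → ℂ)} (b : Module.Basis (Fin p) ℂ U)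
    (f : Module.End ℂ U) {A B : Matrix (Fin n) (Fin n) ℂ}
    (h : ∀ v : U, A *ᵥ (v : Fin n → ℂ) = B *ᵥ (f v : Fin n → ℂ)) :
    A * subspaceCols b = B * subspaceCols b * LinearMap.toMatrix b b f := by
  have h1 : subspaceCols b * LinearMap.toMatrix b b f =
      Matrix.of fun i j => (f (b j) : Fin n → ℂ) i := by
    ext i j
    rw [Matrix.mul_apply, Matrix.of_apply]
    conv_rhs => rw [← b.sum_repr (f (b j))]
    rw [Submodule.coe_sum, Finset.sum_apply]
    refine Finset.sum_congr rfl fun r _ => ?_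
    simp [subspaceCols, LinearMap.toMatrix_apply, mul_comm]
  rw [Matrix.mul_assoc, h1]
  ext i j
  exact congrFun (h (b j)) i

theorem isUnit_joinCols_subspaceCols {p q : ℕ} (h : p + q = n) {U V : Submodule ℂ (Fin n → ℂ)}
    (hUV : IsCompl U V) (b : Module.Basis (Fin p) ℂ U) (c : Module.Basis (Fin q) ℂ V) :
    IsUnit (joinCols h (subspaceCols b) (subspaceCols c)) := by
  let e := ((b.prod c).map (Submodule.prodEquivOfIsCompl U V hUV)).reindex
    (finSumFinEquiv.trans (finCongr h))
  have he : joinCols h (subspaceCols b) (subspaceCols c) =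
      (Pi.basisFun ℂ (Fin n)).toMatrix e := by
    subst h
    ext i j
    induction j using Fin.addCases <;>
      simp [e, joinCols, subspaceCols, Module.Basis.toMatrix_apply]
  rw [he]
  have := (Pi.basisFun ℂ (Fin n)).invertibleToMatrix e
  exact isUnit_of_invertible _

/-- A regular pencil has a Weierstrass canonical form, where the Jordan blocks whose eigenvalue
satisfies `P` come first. -/
theorem IsRegularPencil.exists_weierstrassForm {A B : Matrix (Fin n) (Fin n) ℂ}
    (h : IsRegularPencil A B) (P : ℂ → Prop) :
    ∃ (W : WeierstrassForm A B) (l : ℕ), l ≤ W.m ∧ ∀ i, P (W.eig i) ↔ (i : ℕ) < l := by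
  obtain ⟨R, K, hRK, J, N, hN, hJ, hNK⟩ := h.exists_deflating
  obtain ⟨z, hz⟩ := h
  obtain ⟨m, l, d, eig, b, hd, hl, hP, hb, -⟩ := exists_basis_toMatrix_eq_jordanMatrix J P
  obtain ⟨m', -, d', eig', b', hd', -, -, hb', heig'⟩ :=
    exists_basis_toMatrix_eq_jordanMatrix N fun _ => True
  obtain rfl : eig' = fun _ => 0 := funext fun i => by
    obtain ⟨v, hv⟩ := (heig' i).exists_hasEigenvector
    obtain ⟨r, hr⟩ := hN
    have h1 := hv.pow_apply r
    rw [hr, LinearMap.zero_apply] at h1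
    exact eq_zero_of_pow_eq_zero ((smul_eq_zero.1 h1.symm).resolve_right hv.2)
  have horder : ∑ i, d i + ∑ j, d' j = n := by
    have h1 := Submodule.finrank_add_eq_of_isCompl hRK
    rwa [Module.finrank_eq_card_basis b, Module.finrank_eq_card_basis b', Fintype.card_fin,
      Fintype.card_fin, Module.finrank_fin_fun] at h1
  set S := joinCols horder (subspaceCols b) (subspaceCols b') with hS
  -- `A S = W diag (J, I)` and `B S = W diag (I, N)`, so `T` must be `W⁻¹`. Invertibility of `W`
  -- follows because it is a left factor of the invertible matrix `(zB - A) S`.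
  set W := joinCols horder (B * subspaceCols b) (A * subspaceCols b') with hW
  have hSu : IsUnit S := isUnit_joinCols_subspaceCols horder hRK b b'
  have hAS : A * S = W * diagBlocks horder (jordanMatrix d eig) 1 := by
    rw [hS, hW, mul_joinCols, joinCols_mul_diagBlocks, mul_subspaceCols_eq b J hJ, hb,
      Matrix.mul_one]
  have hBS : B * S = W * diagBlocks horder 1 (jordanMatrix d' fun _ => 0) := by
    rw [hS, hW, mul_joinCols, joinCols_mul_diagBlocks, mul_subspaceCols_eq b' N hNK, hb',
      Matrix.mul_one]
  have hWu : IsUnit W.det := by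
    have h1 : (z • B - A) * S = W * (z • diagBlocks horder 1 (jordanMatrix d' fun _ => 0) -
        diagBlocks horder (jordanMatrix d eig) 1) := by
      rw [Matrix.sub_mul, Matrix.smul_mul, hAS, hBS, Matrix.mul_sub, Matrix.mul_smul]
    have h2 := congrArg Matrix.det h1
    rw [Matrix.det_mul, Matrix.det_mul] at h2
    have h3 := hz.isUnit.mul ((Matrix.isUnit_iff_isUnit_det _).1 hSu)
    rw [h2] at h3
    exact isUnit_of_mul_isUnit_left h3
  refine ⟨⟨m, d, hd, eig, m', d', hd', horder, S, W⁻¹, hSu, ?_, ?_, ?_⟩, l, hl, hP⟩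
  · exact (Matrix.isUnit_nonsing_inv_iff).2 ((Matrix.isUnit_iff_isUnit_det _).2 hWu)
  · rw [Matrix.mul_assoc, hAS, Matrix.nonsing_inv_mul_cancel_left _ _ hWu]
  · rw [Matrix.mul_assoc, hBS, Matrix.nonsing_inv_mul_cancel_left _ _ hWu]

end Weierstrass

/-! ### Stochastic trace estimation -/

section Gaussian

variable {Ω : Type*} [MeasurableSpace Ω] {P : Measure Ω} {n p : ℕ}
  {Y : Ω → Matrix (Fin n) (Fin p) ℝ}

theorem IsStandardGaussianMatrix.memLp (hY : IsStandardGaussianMatrix P Y) (i : Fin n)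
    (j : Fin p) : MemLp (fun ω => Y ω i j) 2 P := by
  have h := memLp_id_gaussianReal (μ := 0) (v := 1) 2
  rw [← (hY.1 i j).map_eq] at h
  exact (memLp_map_measure_iff aestronglyMeasurable_id (hY.1 i j).aemeasurable).1 h

theorem IsStandardGaussianMatrix.integral_eq_zero (hY : IsStandardGaussianMatrix P Y) (i : Fin n)
    (j : Fin p) : ∫ ω, Y ω i j ∂P = 0 := by
  have h := (hY.1 i j).integral_comp (f := id) aestronglyMeasurable_id
  exact h.trans integral_id_gaussianReal

theorem IsStandardGaussianMatrix.integrable_mul (hY : IsStandardGaussianMatrix P Y)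
    (i i' : Fin n) (j j' : Fin p) : Integrable (fun ω => Y ω i j * Y ω i' j') P :=
  (hY.memLp i j).integrable_mul (hY.memLp i' j')

/-- The diagonal case is the variance of a centred variable, the other case is independence.
Consequently only the diagonal entries of `Q` contribute to the expected trace, once for each column
of `Y`. -/
theorem IsStandardGaussianMatrix.integral_mul [IsProbabilityMeasure P]
    (hY : IsStandardGaussianMatrix P Y)
    (i i' : Fin n) (j : Fin p) :
    ∫ ω, Y ω i j * Y ω i' j ∂P = if i = i' then 1 else 0 := by
  split_ifs with h
  · subst h
    have h1 := variance_eq_sub (hY.memLp i j)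
    rw [(hY.1 i j).variance_eq, variance_id_gaussianReal, hY.integral_eq_zero] at h1
    simp only [Pi.pow_apply, NNReal.coe_one, sq, mul_zero, sub_zero] at h1
    exact h1.symm
  · have hind : (fun ω => Y ω i j) ⟂ᵢ[P] (fun ω => Y ω i' j) :=
      hY.2.indepFun (i := (i, j)) (j := (i', j)) fun h' => h (congrArg Prod.fst h')
    have h1 := hind.integral_mul_eq_mul_integral (hY.memLp i j).aestronglyMeasurable
      (hY.memLp i' j).aestronglyMeasurable
    rw [hY.integral_eq_zero, zero_mul] at h1
    exact h1

theorem trace_conjTranspose_mul_mul (Q : Matrix (Fin n) (Fin n) ℂ)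
    (M : Matrix (Fin n) (Fin p) ℝ) :
    ((M.map Complex.ofReal)ᴴ * (Q * M.map Complex.ofReal)).trace =
      ∑ j, ∑ i, ∑ i', Q i i' * ((M i j * M i' j : ℝ) : ℂ) := by
  simp only [Matrix.trace, Matrix.diag_apply, Matrix.mul_apply, Matrix.conjTranspose_apply,
    Matrix.map_apply, Finset.mul_sum]
  refine Finset.sum_congr rfl fun j _ => Finset.sum_congr rfl fun i _ =>
    Finset.sum_congr rfl fun i' _ => ?_
  rw [RCLike.star_def, Complex.conj_ofReal, Complex.ofReal_mul]
  ring

theorem IsStandardGaussianMatrix.integrable_trace (hY : IsStandardGaussianMatrix P Y)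
    (Q : Matrix (Fin n) (Fin n) ℂ) :
    Integrable (fun ω => (((Y ω).map Complex.ofReal)ᴴ *
      (Q * (Y ω).map Complex.ofReal)).trace) P := by
  simp only [trace_conjTranspose_mul_mul]
  exact integrable_finsetSum _ fun j _ => integrable_finsetSum _ fun i _ =>
    integrable_finsetSum _ fun i' _ => (hY.integrable_mul i i' j j).ofReal.const_mul _

theorem IsStandardGaussianMatrix.integral_trace [IsProbabilityMeasure P]
    (hY : IsStandardGaussianMatrix P Y)
    (Q : Matrix (Fin n) (Fin n) ℂ) :
    ∫ ω, (((Y ω).map Complex.ofReal)ᴴ * (Q * (Y ω).map Complex.ofReal)).trace ∂P =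
      p * Q.trace := by
  have hint : ∀ i i' j, Integrable (fun ω => Q i i' * ((Y ω i j * Y ω i' j : ℝ) : ℂ)) P :=
    fun i i' j => (hY.integrable_mul i i' j j).ofReal.const_mul _
  simp only [trace_conjTranspose_mul_mul]
  rw [integral_finsetSum _ fun j _ => integrable_finsetSum _ fun i _ =>
    integrable_finsetSum _ fun i' _ => hint i i' j]
  have hj : ∀ j, ∫ ω, ∑ i, ∑ i', Q i i' * ((Y ω i j * Y ω i' j : ℝ) : ℂ) ∂P = Q.trace := by
    intro j
    rw [integral_finsetSum _ fun i _ => integrable_finsetSum _ fun i' _ => hint i i' j]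
    refine Finset.sum_congr rfl fun i _ => ?_
    rw [integral_finsetSum _ fun i' _ => hint i i' j]
    have hi : ∀ i', ∫ ω, Q i i' * ((Y ω i j * Y ω i' j : ℝ) : ℂ) ∂P =
        if i = i' then Q i i' else 0 := fun i' => by
      rw [integral_const_mul, integral_complex_ofReal, hY.integral_mul]
      split_ifs <;> simp
    rw [Finset.sum_congr rfl fun i' _ => hi i', Finset.sum_ite_eq, if_pos (Finset.mem_univ i),
      Matrix.diag_apply]
  rw [Finset.sum_congr rfl fun j _ => hj j]
  simp

end Gaussian

/-! ### The spectral projector -/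

namespace WeierstrassForm

variable {n : ℕ} {A B : Matrix (Fin n) (Fin n) ℂ} (W : WeierstrassForm A B)

theorem isUnit_det_S : IsUnit W.S.det := (Matrix.isUnit_iff_isUnit_det _).1 W.isUnit_S

theorem isUnit_det_T : IsUnit W.T.det := (Matrix.isUnit_iff_isUnit_det _).1 W.isUnit_T

theorem mul_pencil_mul (z : ℂ) :
    W.T * (z • B - A) * W.S = diagBlocks W.order_eq (z • 1 - jordanMatrix W.d W.eig)
      (z • (jordanMatrix W.d' fun _ => 0) - 1) := by
  rw [Matrix.mul_sub, Matrix.sub_mul, Matrix.mul_smul, Matrix.smul_mul, W.mul_A, W.mul_B,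
    smul_diagBlocks, diagBlocks_sub]

/-- The finite eigenvalues of the pencil, repeated according to the sizes of the Jordan blocks. -/
noncomputable def finiteEig (a : Fin (∑ i, W.d i)) : ℂ := W.eig (blockIndex W.d a)

theorem det_pencil (z : ℂ) :
    W.T.det * (z • B - A).det * W.S.det =
      (∏ a, (z - W.finiteEig a)) * (-1) ^ (∑ j, W.d' j) := by
  rw [← Matrix.det_mul, ← Matrix.det_mul, W.mul_pencil_mul, det_diagBlocks,
    det_smul_one_sub_jordanMatrix, det_smul_jordanMatrix_zero_sub_one]
  rfl

theorem det_pencil_finiteEig (a : Fin (∑ i, W.d i)) : (W.finiteEig a • B - A).det = 0 := by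
  have h := W.det_pencil (W.finiteEig a)
  rw [Finset.prod_eq_zero (Finset.mem_univ a) (sub_self _), zero_mul] at h
  rcases mul_eq_zero.1 h with h | h
  · exact (mul_eq_zero.1 h).resolve_left W.isUnit_det_T.ne_zero
  · exact absurd h W.isUnit_det_S.ne_zero

/-- Up to nonzero constants the polynomial agrees at every `z` with the product of the `X - λ`, so
its roots are the diagonal entries of `J` with multiplicity. -/
theorem roots_pencilPolynomial :
    (pencilPolynomial A B).roots = Finset.univ.val.map W.finiteEig := by
  have heval : ∀ z, (pencilPolynomial A B).eval z = (z • B - A).det := fun z => by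
    rw [pencilPolynomial, ← Polynomial.coe_evalRingHom, RingHom.map_det]
    congr 1
    ext i j
    simpa using mul_comm _ _
  have hc : W.T.det * W.S.det ≠ 0 := mul_ne_zero W.isUnit_det_T.ne_zero W.isUnit_det_S.ne_zero
  have hd : ((-1 : ℂ) ^ (∑ j, W.d' j)) ≠ 0 := pow_ne_zero _ (neg_ne_zero.2 one_ne_zero)
  have h : Polynomial.C (W.T.det * W.S.det) * pencilPolynomial A B =
      Polynomial.C ((-1) ^ (∑ j, W.d' j)) *
        ∏ a, (Polynomial.X - Polynomial.C (W.finiteEig a)) := by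
    refine Polynomial.funext fun z => ?_
    simp only [Polynomial.eval_mul, Polynomial.eval_C, heval, Polynomial.eval_prod,
      Polynomial.eval_sub, Polynomial.eval_X]
    linear_combination W.det_pencil z
  rw [← Polynomial.roots_C_mul _ hc, h, Polynomial.roots_C_mul _ hd]
  have h2 := Polynomial.roots_multiset_prod_X_sub_C (Finset.univ.val.map W.finiteEig)
  rw [Multiset.map_map] at h2
  exact h2

/-- The orthogonal projector onto the first `s = d₁ + ⋯ + d_l` coordinates. -/
noncomputable def leadingProjector (l : ℕ) : Matrix (Fin n) (Fin n) ℂ :=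
  Matrix.diagonal fun i : Fin n => if (i : ℕ) < W.size l then 1 else 0

variable {W} {Γ : SimpleClosedCurve} {l : ℕ}

theorem EnclosedFirst.finiteEig_mem_iff (hl : W.EnclosedFirst Γ l) (a : Fin (∑ i, W.d i)) :
    W.finiteEig a ∈ Γ.inside ↔ (a : ℕ) < W.size l :=
  (hl.2 _).trans (blockIndex_lt_iff W.d l a)

variable (W l) in
theorem diagBlocks_eq_leadingProjector :
    diagBlocks W.order_eq (Matrix.diagonal fun a => if (a : ℕ) < W.size l then (1 : ℂ) else 0) 0 =
      W.leadingProjector l := by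
  have hs : W.size l ≤ ∑ i, W.d i := Finset.sum_le_sum_of_subset (Finset.filter_subset _ _)
  -- Stated for free orders so that `p + q = n` can be substituted away.
  have key : ∀ {p q n s : ℕ} (h : p + q = n), s ≤ p →
      diagBlocks h (Matrix.diagonal fun a : Fin p => if (a : ℕ) < s then (1 : ℂ) else 0) 0 =
        Matrix.diagonal fun i : Fin n => if (i : ℕ) < s then 1 else 0 := by
    intro p q n s h hs
    subst h
    ext i j
    induction i using Fin.addCases with
    | left i =>
      induction j using Fin.addCases with
      | left j => simp [diagBlocks, Matrix.diagonal_apply]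
      | right j =>
        have : Fin.castAdd q i ≠ Fin.natAdd p j := fun h => by
          have := congrArg Fin.val h
          simp only [Fin.val_castAdd, Fin.val_natAdd] at this
          omega
        simp [diagBlocks, Matrix.diagonal_apply_ne _ this]
    | right i =>
      have hi : ¬ p + (i : ℕ) < s := by omega
      induction j using Fin.addCases with
      | left j => simp [diagBlocks, Matrix.diagonal_apply, hi]
      | right j => simp [diagBlocks, Matrix.diagonal_apply, hi]
  exact key W.order_eq hs

theorem isIdempotentElem_leadingProjector : IsIdempotentElem (W.leadingProjector l) := by
  rw [IsIdempotentElem, leadingProjector, Matrix.diagonal_mul_diagonal]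
  congr 1
  ext i
  split_ifs <;> simp

theorem trace_leadingProjector : (W.leadingProjector l).trace = W.size l := by
  rw [leadingProjector, Matrix.trace_diagonal, Finset.sum_boole, Fin.card_filter_val_lt,
    min_eq_right (W.size_le l)]

/-- In `(zB - A)⁻¹ B` the matrix `T` cancels, leaving `S diag ((zI - J)⁻¹, (zN - I)⁻¹ N) S⁻¹`.
Existence of the integral and its value come together, block by block. -/
theorem EnclosedFirst.hasMatrixContourIntegral (hl : W.EnclosedFirst Γ l)
    (hpos : Γ.PositivelyOriented) (hoff : ∀ z ∈ Γ.support, (z • B - A).det ≠ 0) :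
    Γ.HasMatrixContourIntegral (fun z => (z • B - A)⁻¹ * B)
      ((2 * Real.pi * Complex.I) • (W.S * W.leadingProjector l * W.S⁻¹)) := by
  classical
  have heig : ∀ a, W.finiteEig a ∉ Γ.support := fun a ha =>
    hoff _ ha (W.det_pencil_finiteEig a)
  have h1 := hpos.hasMatrixContourIntegral_inv_jordanMatrix W.d W.eig heig
  have h2 := (SimpleClosedCurve.hasMatrixContourIntegral_inv_jordanMatrix_zero (Γ := Γ)
    W.d').mul_const (jordanMatrix W.d' fun _ => 0)
  have h3 := ((h1.diagBlocks W.order_eq h2).const_mul W.S).mul_const W.S⁻¹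
  have hval : diagBlocks W.order_eq ((2 * Real.pi * Complex.I) • Matrix.diagonal fun a =>
      if W.eig (blockIndex W.d a) ∈ Γ.inside then (1 : ℂ) else 0)
      (0 * jordanMatrix W.d' fun _ => 0) =
      (2 * Real.pi * Complex.I) • W.leadingProjector l := by
    rw [← diagBlocks_eq_leadingProjector, smul_diagBlocks, Matrix.zero_mul, smul_zero]
    congr 3
    ext a
    exact if_congr (hl.finiteEig_mem_iff a) rfl rfl
  rw [hval, Matrix.mul_smul, Matrix.smul_mul] at h3
  refine h3.congr fun z hz => ?_
  have hX : IsUnit (z • (1 : Matrix _ _ ℂ) - jordanMatrix W.d W.eig).det := by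
    rw [det_smul_one_sub_jordanMatrix]
    exact (Finset.prod_ne_zero_iff.2 fun a _ => sub_ne_zero.2 fun h =>
      heig a ((h : z = W.finiteEig a) ▸ hz)).isUnit
  have hY : IsUnit (z • (jordanMatrix W.d' fun _ => 0) - 1).det := by
    rw [det_smul_jordanMatrix_zero_sub_one]
    exact (pow_ne_zero _ (neg_ne_zero.2 one_ne_zero)).isUnit
  set X := z • (1 : Matrix _ _ ℂ) - jordanMatrix W.d W.eig
  set Y := z • (jordanMatrix W.d' fun _ => 0) - 1
  have hinv : (z • B - A)⁻¹ = W.S * diagBlocks W.order_eq X⁻¹ Y⁻¹ * W.T := by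
    refine Matrix.inv_eq_left_inv ?_
    have h4 : W.T * (z • B - A) = diagBlocks W.order_eq X Y * W.S⁻¹ := by
      rw [← W.mul_pencil_mul, Matrix.mul_nonsing_inv_cancel_right _ _ W.isUnit_det_S]
    rw [Matrix.mul_assoc, h4, Matrix.mul_assoc, ← Matrix.mul_assoc (diagBlocks _ _ _),
      diagBlocks_mul, Matrix.nonsing_inv_mul _ hX, Matrix.nonsing_inv_mul _ hY, diagBlocks_one,
      Matrix.one_mul, Matrix.mul_nonsing_inv _ W.isUnit_det_S]
  have h5 : W.T * B = diagBlocks W.order_eq 1 (jordanMatrix W.d' fun _ => 0) * W.S⁻¹ := by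
    rw [← W.mul_B, Matrix.mul_nonsing_inv_cancel_right _ _ W.isUnit_det_S]
  rw [hinv, Matrix.mul_assoc _ W.T, h5, ← Matrix.mul_assoc,
    Matrix.mul_assoc W.S (diagBlocks W.order_eq X⁻¹ Y⁻¹), diagBlocks_mul, Matrix.mul_one]

theorem EnclosedFirst.contourProjector_eq (hl : W.EnclosedFirst Γ l)
    (hpos : Γ.PositivelyOriented) (hoff : ∀ z ∈ Γ.support, (z • B - A).det ≠ 0) :
    contourProjector A B Γ = W.S * W.leadingProjector l * W.S⁻¹ := by
  ext i j
  rw [contourProjector, Matrix.of_apply, (hl.hasMatrixContourIntegral hpos hoff i j).2,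
    Matrix.smul_apply, smul_eq_mul, inv_mul_cancel_left₀ (by simp [Real.pi_ne_zero])]

-- Multiplying by the coordinate projector selects the leading columns of `S`. The case `M = S⁻¹`
-- factorizes `Q`; the case `M = 1` identifies the span of these columns as a range.
variable (W l) in
theorem mul_leadingProjector_mul (M : Matrix (Fin n) (Fin n) ℂ) :
    W.S * W.leadingProjector l * M =
      W.leadingCols l * M.submatrix (Fin.castLE (W.size_le l)) id := by
  ext i j
  rw [Matrix.mul_apply, Matrix.mul_apply]
  simp only [leadingProjector, Matrix.mul_diagonal, leadingCols, Matrix.submatrix_apply, id_eq,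
    mul_ite, mul_one, mul_zero, ite_mul, zero_mul]
  rw [← Finset.sum_filter]
  refine (Finset.sum_bij (fun a _ => Fin.castLE (W.size_le l) a) (by simp)
    (fun _ _ _ _ h => Fin.castLE_injective _ h) (fun a ha => ?_) (fun _ _ => rfl)).symm
  exact ⟨⟨a, (Finset.mem_filter.1 ha).2⟩, Finset.mem_univ _, rfl⟩

variable (W l) in
theorem leadingSpan_eq_range :
    W.leadingSpan l = LinearMap.range (W.S * W.leadingProjector l).mulVecLin := by
  have h1 := W.mul_leadingProjector_mul l 1
  rw [Matrix.mul_one] at h1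
  refine le_antisymm ?_ ?_
  · rw [leadingSpan, Submodule.span_le]
    rintro _ ⟨a, rfl⟩
    refine ⟨Pi.single (Fin.castLE (W.size_le l) a) 1, ?_⟩
    ext i
    simp [leadingProjector, leadingCols]
  · rw [h1, Matrix.mulVecLin_mul, leadingSpan, ← Matrix.range_mulVecLin]
    exact LinearMap.range_comp_le_range _ _

theorem range_mulVecLin_projector :
    LinearMap.range (W.S * W.leadingProjector l * W.S⁻¹).mulVecLin = W.leadingSpan l := by
  rw [leadingSpan_eq_range, Matrix.mulVecLin_mul, LinearMap.range_comp_of_range_eq_top]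
  refine LinearMap.range_eq_top.2 fun v => ⟨W.S *ᵥ v, ?_⟩
  rw [Matrix.mulVecLin_apply, Matrix.mulVec_mulVec, Matrix.nonsing_inv_mul _ W.isUnit_det_S,
    Matrix.one_mulVec]

-- As `J` is upper triangular, it preserves the span of the first `s` coordinates, while `TBS` acts
-- there as the identity. Hence `A (S E) = B (S E) (D E)`, with `E` the coordinate projector and `D
-- = TAS`.
variable (W l) in
theorem map_leadingSpan_le :
    (W.leadingSpan l).map A.mulVecLin ≤ (W.leadingSpan l).map B.mulVecLin := by
  set D := diagBlocks W.order_eq (jordanMatrix W.d W.eig) 1 with hD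
  set E := W.leadingProjector l with hE
  have hcomm : D * E = E * (D * E) := by
    rw [hE, ← diagBlocks_eq_leadingProjector, hD, diagBlocks_mul, diagBlocks_mul,
      Matrix.mul_zero, Matrix.mul_zero]
    congr 1
    ext a b
    rw [Matrix.mul_diagonal, Matrix.diagonal_mul, Matrix.mul_diagonal]
    by_cases hb : (b : ℕ) < W.size l
    · by_cases ha : (a : ℕ) < W.size l
      · simp [ha]
      · have hab : jordanMatrix W.d W.eig a b = 0 := by
          rw [jordanMatrix_eq_diagonal_add, Matrix.add_apply,
            Matrix.diagonal_apply_ne _ (fun h : a = b => ha (h ▸ hb)), zero_add]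
          by_contra h
          have := (jordanMatrix_zero_apply_ne_zero _ h).1
          omega
        simp [hab]
    · simp [hb]
  have hBE : diagBlocks W.order_eq 1 (jordanMatrix W.d' fun _ => 0) * E = E := by
    rw [hE, ← diagBlocks_eq_leadingProjector, diagBlocks_mul, Matrix.one_mul, Matrix.mul_zero]
  have key : A * (W.S * E) = B * (W.S * E) * (D * E) := by
    have h1 : W.T * (A * (W.S * E)) = W.T * (B * (W.S * E) * (D * E)) := by
      calc W.T * (A * (W.S * E)) = W.T * A * W.S * E := by simp only [Matrix.mul_assoc]
        _ = E * (D * E) := by rw [W.mul_A, ← hD]; exact hcomm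
        _ = W.T * B * W.S * E * (D * E) := by rw [W.mul_B, hBE]
        _ = _ := by simp only [Matrix.mul_assoc]
    have h2 := congrArg (fun M => W.T⁻¹ * M) h1
    simpa only [Matrix.nonsing_inv_mul_cancel_left _ _ W.isUnit_det_T] using h2
  rw [leadingSpan_eq_range, ← LinearMap.range_comp, ← LinearMap.range_comp,
    ← Matrix.mulVecLin_mul, ← Matrix.mulVecLin_mul, key, Matrix.mulVecLin_mul]
  exact LinearMap.range_comp_le_range _ _

theorem EnclosedFirst.eigenvalueCount_eq (hl : W.EnclosedFirst Γ l) :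
    eigenvalueCount A B Γ = W.size l := by
  classical
  have hs : W.size l ≤ ∑ i, W.d i := Finset.sum_le_sum_of_subset (Finset.filter_subset _ _)
  have h1 : eigenvalueCount A B Γ =
      (Finset.univ.filter fun a : Fin (∑ i, W.d i) => (a : ℕ) < W.size l).card := by
    rw [eigenvalueCount, W.roots_pencilPolynomial, Multiset.filter_map, Multiset.card_map,
      Finset.card_def, Finset.filter_val]
    congr 1
    exact Multiset.filter_congr fun a _ => hl.finiteEig_mem_iff a
  rw [h1, Fin.card_filter_val_lt, min_eq_right hs]

end WeierstrassForm

/-- The contour projector fixes the eigenvectors with enclosed eigenvalues. -/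
theorem contourProjector_mulVec_eq {n : ℕ} {A B : Matrix (Fin n) (Fin n) ℂ}
    {Γ : SimpleClosedCurve} (hpos : Γ.PositivelyOriented)
    (hoff : ∀ z ∈ Γ.support, (z • B - A).det ≠ 0)
    (hint : ∀ i j, Γ.ContourIntegrable (fun z => ((z • B - A)⁻¹ * B) i j)) {μ : ℂ}
    (hμ : μ ∈ Γ.inside) {x : Fin n → ℂ} (hx : x ∈ pencilEigenspace A B μ) :
    contourProjector A B Γ *ᵥ x = x := by
  have hx' : (μ • B - A) *ᵥ x = 0 := hx
  ext i
  have h1 : Γ.HasContourIntegral (fun z => ∑ j, ((z • B - A)⁻¹ * B) i j * x j)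
      (∑ j, Γ.contourIntegral (fun z => ((z • B - A)⁻¹ * B) i j) * x j) :=
    SimpleClosedCurve.HasContourIntegral.sum _ fun j _ =>
      SimpleClosedCurve.HasContourIntegral.mul_const _ ⟨hint i j, rfl⟩
  have h2 : Γ.HasContourIntegral (fun z => ∑ j, ((z • B - A)⁻¹ * B) i j * x j)
      (2 * Real.pi * Complex.I * x i) := by
    have h3 := (hpos.hasContourIntegral_inv_sub hμ.1).mul_const (x i)
    rw [if_pos hμ] at h3
    refine h3.congr fun z hz => ?_
    have hzμ : z - μ ≠ 0 := sub_ne_zero.2 fun h => hμ.1 (h ▸ hz)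
    have h4 : (z • B - A) *ᵥ x = (z - μ) • B *ᵥ x := by
      have h5 : z • B - A = (z - μ) • B + (μ • B - A) := by
        rw [sub_smul]; abel
      rw [h5, Matrix.add_mulVec, hx', add_zero, Matrix.smul_mulVec]
    -- On an eigenvector the matrix integrand collapses to a scalar, whose integral is `2πi` because
    -- `μ` is enclosed; no canonical form enters.
    have h6 : ((z • B - A)⁻¹ * B) *ᵥ x = (z - μ)⁻¹ • x := by
      have h7 : B *ᵥ x = (z - μ)⁻¹ • ((z • B - A) *ᵥ x) := by
        rw [h4, smul_smul, inv_mul_cancel₀ hzμ, one_smul]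
      rw [← Matrix.mulVec_mulVec, h7, Matrix.mulVec_smul, Matrix.mulVec_mulVec,
        Matrix.nonsing_inv_mul _ (hoff z hz).isUnit, Matrix.one_mulVec]
    exact (congrFun h6 i).symm
  have h3 := h1.2.symm.trans h2.2
  have hpi : (2 * Real.pi * Complex.I : ℂ) ≠ 0 := by simp [Real.pi_ne_zero]
  calc (contourProjector A B Γ *ᵥ x) i
      = (2 * Real.pi * Complex.I)⁻¹ *
        ∑ j, Γ.contourIntegral (fun z => ((z • B - A)⁻¹ * B) i j) * x j := by
        simp only [Matrix.mulVec, dotProduct, contourProjector, Matrix.of_apply, Finset.mul_sum,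
          mul_assoc]
    _ = x i := by rw [h3, inv_mul_cancel_left₀ hpi]

theorem mainTheorem3 {n : ℕ} (A B : Matrix (Fin n) (Fin n) ℂ) (hreg : IsRegularPencil A B)
    (Γ : SimpleClosedCurve) (hpos : Γ.PositivelyOriented)
    (hoff : ∀ z ∈ Γ.support, (z • B - A).det ≠ 0) :
    (∀ i j, Γ.ContourIntegrable (fun z => ((z • B - A)⁻¹ * B) i j)) ∧
    (∃ (W : WeierstrassForm A B) (l : ℕ), W.EnclosedFirst Γ l) ∧
    ∀ (W : WeierstrassForm A B) (l : ℕ), W.EnclosedFirst Γ l →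
      contourProjector A B Γ =
        W.S * Matrix.diagonal (fun i : Fin n => if (i : ℕ) < W.size l then (1 : ℂ) else 0) * W.S⁻¹ ∧
      contourProjector A B Γ = W.leadingCols l * W.leadingInvRows l ∧
      IsIdempotentElem (contourProjector A B Γ) ∧
      LinearMap.range (contourProjector A B Γ).mulVecLin = W.leadingSpan l ∧
      (∀ μ ∈ Γ.inside, pencilEigenspace A B μ ≤ W.leadingSpan l) ∧
      (W.leadingSpan l).map A.mulVecLin ≤ (W.leadingSpan l).map B.mulVecLin ∧
      eigenvalueCount A B Γ = W.size l ∧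
      (contourProjector A B Γ).trace = (W.size l : ℂ) ∧
      ∀ {Ω : Type*} [MeasurableSpace Ω] (P : Measure Ω) [IsProbabilityMeasure P] (p : ℕ),
        0 < p → ∀ Y : Ω → Matrix (Fin n) (Fin p) ℝ, IsStandardGaussianMatrix P Y →
          Integrable (fun ω => (((Y ω).map Complex.ofReal)ᴴ *
            (contourProjector A B Γ * (Y ω).map Complex.ofReal)).trace) P ∧
          (1 / (p : ℂ)) * ∫ ω, (((Y ω).map Complex.ofReal)ᴴ *
            (contourProjector A B Γ * (Y ω).map Complex.ofReal)).trace ∂P = (W.size l : ℂ) := by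
  obtain ⟨W₀, l₀, h₀⟩ := hreg.exists_weierstrassForm (· ∈ Γ.inside)
  have hint : ∀ i j, Γ.ContourIntegrable (fun z => ((z • B - A)⁻¹ * B) i j) := fun i j =>
    (WeierstrassForm.EnclosedFirst.hasMatrixContourIntegral (W := W₀) h₀ hpos hoff i j).1
  refine ⟨hint, ⟨W₀, l₀, h₀⟩, fun W l hl => ?_⟩
  have hQ := hl.contourProjector_eq hpos hoff
  have hrange : LinearMap.range (contourProjector A B Γ).mulVecLin = W.leadingSpan l := by
    rw [hQ, WeierstrassForm.range_mulVecLin_projector]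
  have htrace : (contourProjector A B Γ).trace = (W.size l : ℂ) := by
    rw [hQ, Matrix.trace_mul_comm, Matrix.nonsing_inv_mul_cancel_left _ _ W.isUnit_det_S,
      WeierstrassForm.trace_leadingProjector]
  refine ⟨hQ, hQ.trans (W.mul_leadingProjector_mul l _), ?_, hrange, fun μ hμ x hx => ?_,
    W.map_leadingSpan_le l, hl.eigenvalueCount_eq, htrace, ?_⟩
  · rw [hQ, IsIdempotentElem, Matrix.mul_assoc, Matrix.mul_assoc W.S, ← Matrix.mul_assoc W.S⁻¹,
      Matrix.nonsing_inv_mul_cancel_left _ _ W.isUnit_det_S, ← Matrix.mul_assoc _ _ W.S⁻¹,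
      WeierstrassForm.isIdempotentElem_leadingProjector.eq, Matrix.mul_assoc]
  -- A vector fixed by `Q` lies in its range.
  · rw [← hrange]
    exact ⟨x, contourProjector_mulVec_eq hpos hoff hint hμ hx⟩
  · intro Ω _ P _ p hp Y hY
    refine ⟨hY.integrable_trace _, ?_⟩
    have hp' : (p : ℂ) ≠ 0 := Nat.cast_ne_zero.2 hp.ne'
    rw [hY.integral_trace, htrace, one_div, inv_mul_cancel_left₀ hp']
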